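/- Let Ł be Łukasiewicz propositional logic (connectives $\to,\neg$, with a constant $\bot$ and the axiom $\bot\to\varphi$; axioms $\varphi\to(\psi\to\varphi)$, $(\varphi\to\psi)\to((\psi\to\chi)\to(\varphi\to\chi))$, $(\varphi\vee\psi)\to(\psi\vee\varphi)$ with $\varphi\vee\psi:=(\varphi\to\psi)\to\psi$, $(\neg\psi\to\neg\varphi)\to(\varphi\to\psi)$; only rule: modus ponens). Let $\mathcal R$Ł (respectively $\mathcal Q$Ł) be its extension by unary connectives $\nabla_r$ for all $r\in[0,1]$ (respectively all $r\in[0,1]\cap\mathbb Q$) with the axioms $\nabla_r(\varphi\to\psi)\leftrightarrow(\nabla_r\varphi\to\nabla_r\psi)$, $\nabla_{\max(r-q,0)}\varphi\leftrightarrow(\nabla_q\varphi\to\nabla_r\varphi)$, $\nabla_r\nabla_q\varphi\leftrightarrow\nabla_{rq}\varphi$, $\nabla_1\varphi\leftrightarrow\varphi$. For a set $X$ of variables let $MV_X$, $DMV_X$, $RMV_X$ be the Lindenbaum–Tarski algebras of Ł, $\mathcal Q$Ł, $\mathcal R$Ł over $X$. They are an MV-algebra, a DMV-algebra and a Riesz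 MV-algebra with $[\varphi]\oplus[\psi]=[\neg\varphi\to\psi]$, $[\varphi]^*=[\neg\varphi]$, $0=[\bot]$, $r[\varphi]=[\neg\nabla_r\neg\varphi]$. Let $\iota_X$ denote the canonical MV-homomorphism from $MV_X$ to $DMV_X$, to $RMV_X$, fixing the variables. An ideal is a downward closed subset containing $0$ and closed under $\oplus$; $(S]$ denotes the ideal generated by $S$, with a subscript for the algebra. Let $\mathbf{ThMV}$ be the category whose objects are the pairs $(X,I)$ with $X$ a set and $I$ a finitely generated ideal of $MV_X$, and whose arrows $(X,I)\to(Y,J)$ are the MV-homomorphisms $\sigma:MV_X\to MV_Y$ with $\sigma(I)\subseteq J$. Let $\mathbf{ThDMV}'$ be the category whose objects are the pairs $(X,I)$ with $I$ a finitely generated ideal of $DMV_X$, and whose arrows are the DMV-homomorphisms $\sigma:DMV_X\to DMV_Y$ with $\sigma(I)\subseteq J$ and $\sigma(X)\subseteq\iota_Y(MV_Y)$. Let $\mathbf{ThRMV}'$ be the category whose objects are the pairs $(X,I)$ with $I$ an ideal of $RMV_X$ generated by a single element of (the image of) $DMV_X$, and whose arrows are the Riesz MV-homomorphisms $\tau:RMV_X\to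 RMV_Y$ with $\tau(I)\subseteq J$ and $\tau(X)\subseteq\iota_Y(MV_Y)$. Theorem. The following defines a functor $\mathcal{DT}:\mathbf{ThMV}\to\mathbf{ThDMV}'$: on objects $\mathcal{DT}(X,I)=(X,(\iota_X(I)]_{DMV})$; on arrows, $\mathcal{DT}(\sigma)$ is the unique DMV-homomorphism $\sigma_D:DMV_X\to DMV_Y$ with $\sigma_D(x)=\iota_Y(\sigma(x))$ for all $x\in X$. The functor $\mathcal{DT}$ is an equivalence of categories. Likewise, $(X,I)\mapsto(X,(\iota_X(I)]_{RMV})$, with $\sigma$ sent to the unique Riesz MV-homomorphism $\sigma_R:RMV_X\to RMV_Y$ such that $\sigma_R(x)=\iota_Y(\sigma(x))$ for all $x\in X$, defines a functor $\mathbf{ThMV}\to\mathbf{ThRMV}'$ which is an equivalence of categories. In particular the three categories are equivalent. -/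

import Mathlib

open CategoryTheory

universe u v w

namespace Luk

/-! ## MV-algebras, ideals, scalar multiplications -/

/-- MV-algebras `(A, ⊕, *, 0)`. -/
class MVAlgebra (A : Type u) where
  oplus : A → A → A
  neg : A → A
  zero : A
  oplus_assoc : ∀ x y z : A, oplus (oplus x y) z = oplus x (oplus y z)
  oplus_comm : ∀ x y : A, oplus x y = oplus y x
  oplus_zero : ∀ x : A, oplus x zero = x
  neg_neg : ∀ x : A, neg (neg x) = x
  luk : ∀ x y : A, oplus (neg (oplus (neg x) y)) y = oplus (neg (oplus (neg y) x)) x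
  neg_zero_oplus : ∀ x : A, oplus (neg zero) x = neg zero

namespace MVAlgebra

/-- `1 = 0*`. -/
def one {A : Type u} [MVAlgebra A] : A := neg zero

/-- `x ⊙ y = (x* ⊕ y*)*`. -/
def odot {A : Type u} [MVAlgebra A] (x y : A) : A := neg (oplus (neg x) (neg y))

/-- The natural order: `x ≤ y` iff `x → y = x* ⊕ y` is `1`. -/
def le {A : Type u} [MVAlgebra A] (x y : A) : Prop := oplus (neg x) y = one

theorem neg_oplus_self {A : Type u} [MVAlgebra A] (x : A) : oplus (neg x) x = one := by
  have h := luk (one : A) x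
  have h1 : ∀ y : A, oplus y one = one := fun y => by
    rw [oplus_comm]; exact neg_zero_oplus y
  rw [h1] at h
  have h2 : (neg one : A) = zero := neg_neg _
  rw [h2, oplus_comm zero x, oplus_zero] at h
  exact h

theorem le_oplus {A : Type u} [MVAlgebra A] (x y : A) : le x (oplus x y) := by
  unfold le
  rw [← oplus_assoc, neg_oplus_self]
  exact neg_zero_oplus y

end MVAlgebra

open MVAlgebra

/-- Ideals of an MV-algebra: downward closed sets that contain `0` and are closed under `⊕`. -/
structure MVIdeal (A : Type u) [MVAlgebra A] where
  carrier : Set A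
  zero_mem : zero ∈ carrier
  oplus_mem : ∀ {x y : A}, x ∈ carrier → y ∈ carrier → oplus x y ∈ carrier
  lower : ∀ {x y : A}, le x y → y ∈ carrier → x ∈ carrier

namespace MVIdeal

theorem ext' {A : Type u} [MVAlgebra A] {I J : MVIdeal A} (h : I.carrier = J.carrier) : I = J := by
  cases I; cases J; cases h; rfl

/-- The ideal generated by a set: the smallest ideal that contains it. -/
def span {A : Type u} [MVAlgebra A] (s : Set A) : MVIdeal A where
  carrier := {x | ∀ I : MVIdeal A, s ⊆ I.carrier → x ∈ I.carrier}
  zero_mem := fun I _ => I.zero_mem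
  oplus_mem := fun hx hy I hI => I.oplus_mem (hx I hI) (hy I hI)
  lower := fun h hy I hI => I.lower h (hy I hI)

/-- The ideal is generated by a finite set. -/
def FG {A : Type u} [MVAlgebra A] (I : MVIdeal A) : Prop :=
  ∃ t : Set A, t.Finite ∧ I = span t

theorem subset_span {A : Type u} [MVAlgebra A] (s : Set A) : s ⊆ (span s).carrier :=
  fun _ hx _ hI => hI hx

theorem span_le {A : Type u} [MVAlgebra A] {s : Set A} {I : MVIdeal A} (h : s ⊆ I.carrier) :
    (span s).carrier ⊆ I.carrier := fun _ hx => hx I h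

theorem oplus_mem_iff {A : Type u} [MVAlgebra A] (I : MVIdeal A) (x y : A) :
    oplus x y ∈ I.carrier ↔ x ∈ I.carrier ∧ y ∈ I.carrier := by
  constructor
  · intro h
    exact ⟨I.lower (le_oplus x y) h,
      I.lower (by rw [MVAlgebra.oplus_comm]; exact le_oplus y x) h⟩
  · rintro ⟨h1, h2⟩
    exact I.oplus_mem h1 h2

theorem exists_single {A : Type u} [MVAlgebra A] {t : Set A} (ht : t.Finite) :
    ∃ a : A, ∀ I : MVIdeal A, t ⊆ I.carrier ↔ a ∈ I.carrier := by
  induction t, ht using Set.Finite.induction_on with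
  | empty => exact ⟨zero, fun I => ⟨fun _ => I.zero_mem, fun _ => Set.empty_subset _⟩⟩
  | @insert b s _ _ ih =>
    obtain ⟨a, ha⟩ := ih
    refine ⟨oplus b a, fun I => ?_⟩
    rw [oplus_mem_iff, Set.insert_subset_iff, ha I]

end MVIdeal

/-- The standard MV-algebra on the real unit interval: `x ⊕ y = min (1, x + y)`, `x* = 1 - x`. -/
noncomputable instance : MVAlgebra unitInterval where
  oplus x y := ⟨min 1 ((x : ℝ) + y), le_min zero_le_one (add_nonneg x.2.1 y.2.1), min_le_left _ _⟩
  neg x := ⟨1 - (x : ℝ), sub_nonneg.2 x.2.2, sub_le_self _ x.2.1⟩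
  zero := 0
  oplus_assoc := by
    rintro ⟨x, hx0, hx1⟩ ⟨y, hy0, hy1⟩ ⟨z, hz0, hz1⟩
    apply Subtype.ext
    simp only [min_def]
    split_ifs <;> linarith
  oplus_comm x y := by
    apply Subtype.ext
    simp only [add_comm]
  oplus_zero := by
    rintro ⟨x, hx0, hx1⟩
    apply Subtype.ext
    simp [hx1]
  neg_neg x := by
    apply Subtype.ext
    simp
  luk := by
    rintro ⟨x, hx0, hx1⟩ ⟨y, hy0, hy1⟩
    apply Subtype.ext
    simp only [min_def]
    split_ifs <;> linarith
  neg_zero_oplus := by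
    rintro ⟨x, hx0, hx1⟩
    apply Subtype.ext
    simp [hx0]

/-- A set of scalars in `[0,1]`, closed under `r ⊙ q*` and products, and containing `1` unless it
is empty. -/
structure ScalarSet where
  carrier : Set unitInterval
  sub_mem : ∀ {r q : unitInterval}, r ∈ carrier → q ∈ carrier → odot r (neg q) ∈ carrier
  mul_mem : ∀ {r q : unitInterval}, r ∈ carrier → q ∈ carrier → r * q ∈ carrier
  one_mem : ∀ {r : unitInterval}, r ∈ carrier → (1 : unitInterval) ∈ carrier

/-- The scalars of an element of a `ScalarSet`. -/
abbrev ScalarSet.Elt (S : ScalarSet) : Type := {r : unitInterval // r ∈ S.carrier}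

/-- `r ⊙ q*` in the set of scalars. -/
noncomputable def ScalarSet.sub {S : ScalarSet} (r q : S.Elt) : S.Elt :=
  ⟨odot r.1 (neg q.1), S.sub_mem r.2 q.2⟩

/-- `r · q` in the set of scalars. -/
noncomputable def ScalarSet.mul {S : ScalarSet} (r q : S.Elt) : S.Elt :=
  ⟨r.1 * q.1, S.mul_mem r.2 q.2⟩

/-- No scalars: the case of MV-algebras and of Łukasiewicz logic. -/
def mvScalars : ScalarSet where
  carrier := ∅
  sub_mem := fun h => h.elim
  mul_mem := fun h => h.elim
  one_mem := fun h => h.elim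

/-- The scalars `[0,1] ∩ ℚ`: the case of DMV-algebras and of rational Łukasiewicz logic. -/
def dmvScalars : ScalarSet where
  carrier := {r | ∃ q : ℚ, (q : ℝ) = (r : ℝ)}
  sub_mem := by
    rintro r q ⟨a, ha⟩ ⟨b, hb⟩
    refine ⟨1 - min 1 ((1 - a) + (1 - (1 - b))), ?_⟩
    push_cast
    rw [ha, hb]
    rfl
  mul_mem := by
    rintro r q ⟨a, ha⟩ ⟨b, hb⟩
    exact ⟨a * b, by push_cast; rw [ha, hb]⟩
  one_mem := fun _ => ⟨1, by simp⟩

/-- All scalars in `[0,1]`: the case of Riesz MV-algebras and of the logic `ℛŁ`. -/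
def rmvScalars : ScalarSet where
  carrier := Set.univ
  sub_mem := fun _ _ => trivial
  mul_mem := fun _ _ => trivial
  one_mem := fun _ => trivial

/-- MV-algebras with a scalar multiplication by the scalars in `S`. These are the MV-algebras for
`mvScalars`, the DMV-algebras for `dmvScalars`, and the Riesz MV-algebras for `rmvScalars`. -/
class ScalarMVAlgebra (S : ScalarSet) (A : Type u) extends MVAlgebra A where
  scal : S.Elt → A → A
  scal_odot_neg : ∀ (r : S.Elt) (x y : A),
    scal r (odot x (neg y)) = odot (scal r x) (neg (scal r y))
  sub_scal : ∀ (r q : S.Elt) (x : A),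
    scal (ScalarSet.sub r q) x = odot (scal r x) (neg (scal q x))
  scal_scal : ∀ (r q : S.Elt) (x : A), scal r (scal q x) = scal (ScalarSet.mul r q) x
  one_scal : ∀ (h : (1 : unitInterval) ∈ S.carrier) (x : A), scal ⟨1, h⟩ x = x

/-- Homomorphisms: MV-homomorphisms that commute with the scalars in `S` (no condition for
`mvScalars`). -/
@[ext]
structure ScalarHom (S : ScalarSet) (A : Type u) (B : Type v)
    [ScalarMVAlgebra S A] [ScalarMVAlgebra S B] where
  toFun : A → B
  map_zero : toFun zero = zero
  map_oplus : ∀ x y : A, toFun (oplus x y) = oplus (toFun x) (toFun y)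
  map_neg : ∀ x : A, toFun (neg x) = neg (toFun x)
  map_scal : ∀ (r : S.Elt) (x : A),
    toFun (ScalarMVAlgebra.scal r x) = ScalarMVAlgebra.scal r (toFun x)

namespace ScalarHom

/-- The identity homomorphism. -/
def id (S : ScalarSet) (A : Type u) [ScalarMVAlgebra S A] : ScalarHom S A A :=
  ⟨fun x => x, rfl, fun _ _ => rfl, fun _ => rfl, fun _ _ => rfl⟩

/-- Composition, first `f`, then `g`. -/
def comp {S : ScalarSet} {A : Type u} {B : Type v} {C : Type w} [ScalarMVAlgebra S A]
    [ScalarMVAlgebra S B] [ScalarMVAlgebra S C] (f : ScalarHom S A B) (g : ScalarHom S B C) :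
    ScalarHom S A C where
  toFun x := g.toFun (f.toFun x)
  map_zero := by rw [f.map_zero, g.map_zero]
  map_oplus x y := by rw [f.map_oplus, g.map_oplus]
  map_neg x := by rw [f.map_neg, g.map_neg]
  map_scal r x := by rw [f.map_scal, g.map_scal]

end ScalarHom

/-! ## The logics and their Lindenbaum-Tarski algebras -/

/-- Formulas over the variables `X` with a unary connective `∇_r` for every scalar `r` in `S`. The
constant `⊥` makes sure that there are formulas when `X` is empty. -/
inductive Formula (S : ScalarSet) (X : Type u) : Type u
  | var : X → Formula S X
  | bot : Formula S X
  | neg : Formula S X → Formula S X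
  | imp : Formula S X → Formula S X → Formula S X
  | nabla : S.Elt → Formula S X → Formula S X

namespace Formula

/-- `φ ∨ ψ` is `(φ → ψ) → ψ`. -/
def or {S : ScalarSet} {X : Type u} (φ ψ : Formula S X) : Formula S X := imp (imp φ ψ) ψ

/-- `Δ_r φ = ¬ ∇_r ¬ φ`. -/
def delta {S : ScalarSet} {X : Type u} (r : S.Elt) (φ : Formula S X) : Formula S X :=
  neg (nabla r (neg φ))

/-- Substitution of formulas for variables. -/
def subst {S : ScalarSet} {X : Type u} {Y : Type v} (s : X → Formula S Y) :
    Formula S X → Formula S Y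
  | var x => s x
  | bot => bot
  | neg φ => neg (subst s φ)
  | imp φ ψ => imp (subst s φ) (subst s ψ)
  | nabla r φ => nabla r (subst s φ)

/-- A formula, read in a language with more scalars. -/
def lift {S S' : ScalarSet} (h : S.carrier ⊆ S'.carrier) {X : Type u} :
    Formula S X → Formula S' X
  | var x => var x
  | bot => bot
  | neg φ => neg (lift h φ)
  | imp φ ψ => imp (lift h φ) (lift h ψ)
  | nabla r φ => nabla ⟨r.1, h r.2⟩ (lift h φ)

end Formula

open Formula

/-- Provability. The axioms are (L1)-(L4) of Łukasiewicz logic, `⊥ → φ`, and the axioms (R1)-(R4)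
on the connectives `∇_r` (each equivalence as two implications); the only rule is modus ponens. This
is Łukasiewicz logic for `mvScalars`, rational Łukasiewicz logic `𝒬Ł` for `dmvScalars`, and the
logic `ℛŁ` of Riesz MV-algebras for `rmvScalars`. -/
inductive Provable {S : ScalarSet} {X : Type u} : Formula S X → Prop
  | L1 (φ ψ : Formula S X) : Provable (imp φ (imp ψ φ))
  | L2 (φ ψ χ : Formula S X) : Provable (imp (imp φ ψ) (imp (imp ψ χ) (imp φ χ)))
  | L3 (φ ψ : Formula S X) : Provable (imp (or φ ψ) (or ψ φ))
  | L4 (φ ψ : Formula S X) : Provable (imp (imp (neg ψ) (neg φ)) (imp φ ψ))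
  | efq (φ : Formula S X) : Provable (imp bot φ)
  | R1 (r : S.Elt) (φ ψ : Formula S X) :
      Provable (imp (nabla r (imp φ ψ)) (imp (nabla r φ) (nabla r ψ)))
  | R1' (r : S.Elt) (φ ψ : Formula S X) :
      Provable (imp (imp (nabla r φ) (nabla r ψ)) (nabla r (imp φ ψ)))
  | R2 (r q : S.Elt) (φ : Formula S X) :
      Provable (imp (nabla (ScalarSet.sub r q) φ) (imp (nabla q φ) (nabla r φ)))
  | R2' (r q : S.Elt) (φ : Formula S X) :
      Provable (imp (imp (nabla q φ) (nabla r φ)) (nabla (ScalarSet.sub r q) φ))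
  | R3 (r q : S.Elt) (φ : Formula S X) :
      Provable (imp (nabla r (nabla q φ)) (nabla (ScalarSet.mul r q) φ))
  | R3' (r q : S.Elt) (φ : Formula S X) :
      Provable (imp (nabla (ScalarSet.mul r q) φ) (nabla r (nabla q φ)))
  | R4 (h : (1 : unitInterval) ∈ S.carrier) (φ : Formula S X) :
      Provable (imp (nabla ⟨1, h⟩ φ) φ)
  | R4' (h : (1 : unitInterval) ∈ S.carrier) (φ : Formula S X) :
      Provable (imp φ (nabla ⟨1, h⟩ φ))
  | mp {φ ψ : Formula S X} : Provable φ → Provable (imp φ ψ) → Provable ψ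

namespace Provable

variable {S : ScalarSet} {X : Type u}

theorem trans {a b c : Formula S X} (h : Provable (imp a b)) (k : Provable (imp b c)) :
    Provable (imp a c) := mp k (mp h (L2 a b c))

theorem assertion (a b : Formula S X) : Provable (imp a (imp (imp a b) b)) :=
  trans (L1 a (imp b a)) (L3 b a)

theorem exch (a b c : Formula S X) :
    Provable (imp (imp a (imp b c)) (imp b (imp a c))) :=
  trans (L2 a (imp b c) c) (mp (assertion b c) (L2 b (imp (imp b c) c) (imp a c)))

theorem refl (a : Formula S X) : Provable (imp a a) :=
  mp (L1 a a) (mp (L1 a (imp a (imp a a))) (exch a (imp a (imp a a)) a))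

theorem const {b : Formula S X} (a : Formula S X) (h : Provable b) : Provable (imp a b) :=
  mp h (L1 b a)

theorem dne (a : Formula S X) : Provable (imp (neg (neg a)) a) := by
  let T : Formula S X := imp a a
  have hT : Provable T := refl a
  have h1 : Provable (imp (neg (neg a)) (imp T a)) :=
    trans (L1 (neg (neg a)) (neg (neg T))) (trans (L4 (neg a) (neg T)) (L4 T a))
  exact mp hT (mp h1 (exch _ _ _))

theorem dni (a : Formula S X) : Provable (imp a (neg (neg a))) := mp (dne (neg a)) (L4 _ _)

theorem suffix {a b : Formula S X} (c : Formula S X) (h : Provable (imp a b)) :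
    Provable (imp (imp b c) (imp a c)) := mp h (L2 a b c)

theorem prefix' {b c : Formula S X} (a : Formula S X) (h : Provable (imp b c)) :
    Provable (imp (imp a b) (imp a c)) := mp h (mp (L2 a b c) (exch _ _ _))

theorem contra (a b : Formula S X) : Provable (imp (imp a b) (imp (neg b) (neg a))) :=
  trans (trans (suffix b (dne a)) (prefix' (neg (neg a)) (dni b))) (L4 _ _)

theorem not_bot : Provable (neg bot : Formula S X) :=
  mp (mp (refl bot) (dni (imp bot bot))) (mp (efq (neg (imp bot bot))) (contra _ _))

/-- From `φ`, infer `∇_r φ`. -/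
theorem nec (r : S.Elt) {a : Formula S X} (h : Provable a) : Provable (nabla r a) := by
  let o : S.Elt := ⟨1, S.one_mem r.2⟩
  have h0 : Provable (nabla (ScalarSet.sub r r) a) := mp (refl (nabla r a)) (R2' r r a)
  have h1 : ScalarSet.sub r o = ScalarSet.sub r r := by
    apply Subtype.ext
    apply Subtype.ext
    change 1 - min 1 ((1 - (r.1 : ℝ)) + (1 - (1 - ((1 : unitInterval) : ℝ))))
      = 1 - min 1 ((1 - (r.1 : ℝ)) + (1 - (1 - (r.1 : ℝ))))
    have hr := r.1.2.1
    rw [min_eq_left, min_eq_left]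
    · linarith
    · have h1 : ((1 : unitInterval) : ℝ) = 1 := rfl
      rw [h1]; linarith [r.1.2.2]
  rw [← h1] at h0
  exact mp (mp h (R4' (S.one_mem r.2) a)) (mp h0 (R2 r o a))

theorem nabla_mono (r : S.Elt) {a b : Formula S X} (h : Provable (imp a b)) :
    Provable (imp (nabla r a) (nabla r b)) := mp (nec r h) (R1 r a b)

theorem subst {Y : Type v} (s : X → Formula S Y) {φ : Formula S X} (h : Provable φ) :
    Provable (φ.subst s) := by
  induction h with
  | L1 φ ψ => exact L1 _ _
  | L2 φ ψ χ => exact L2 _ _ _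
  | L3 φ ψ => exact L3 _ _
  | L4 φ ψ => exact L4 _ _
  | efq φ => exact efq _
  | R1 r φ ψ => exact R1 _ _ _
  | R1' r φ ψ => exact R1' _ _ _
  | R2 r q φ => exact R2 _ _ _
  | R2' r q φ => exact R2' _ _ _
  | R3 r q φ => exact R3 _ _ _
  | R3' r q φ => exact R3' _ _ _
  | R4 h φ => exact R4 h _
  | R4' h φ => exact R4' h _
  | mp _ _ h1 h2 => exact mp h1 h2

theorem lift {S' : ScalarSet} (hS : S.carrier ⊆ S'.carrier) {φ : Formula S X} (h : Provable φ) :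
    Provable (φ.lift hS) := by
  induction h with
  | L1 φ ψ => exact L1 _ _
  | L2 φ ψ χ => exact L2 _ _ _
  | L3 φ ψ => exact L3 _ _
  | L4 φ ψ => exact L4 _ _
  | efq φ => exact efq _
  | R1 r φ ψ => exact R1 _ _ _
  | R1' r φ ψ => exact R1' _ _ _
  | R2 r q φ => exact R2 ⟨r.1, hS r.2⟩ ⟨q.1, hS q.2⟩ _
  | R2' r q φ => exact R2' ⟨r.1, hS r.2⟩ ⟨q.1, hS q.2⟩ _
  | R3 r q φ => exact R3 ⟨r.1, hS r.2⟩ ⟨q.1, hS q.2⟩ _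
  | R3' r q φ => exact R3' ⟨r.1, hS r.2⟩ ⟨q.1, hS q.2⟩ _
  | R4 h φ => exact R4 (hS h) _
  | R4' h φ => exact R4' (hS h) _
  | mp _ _ h1 h2 => exact mp h1 h2

end Provable

/-- Provable equivalence of formulas. -/
def equivSetoid (S : ScalarSet) (X : Type u) : Setoid (Formula S X) where
  r φ ψ := Provable (imp φ ψ) ∧ Provable (imp ψ φ)
  iseqv := ⟨fun φ => ⟨.refl φ, .refl φ⟩, fun h => ⟨h.2, h.1⟩,
    fun h k => ⟨h.1.trans k.1, k.2.trans h.2⟩⟩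

/-- The Lindenbaum-Tarski algebra over the variables `X`. -/
def LTAlg (S : ScalarSet) (X : Type u) : Type u := Quotient (equivSetoid S X)

/-- `MV_X`. -/
abbrev MVFree (X : Type u) : Type u := LTAlg mvScalars X

/-- `DMV_X`. -/
abbrev DMVFree (X : Type u) : Type u := LTAlg dmvScalars X

/-- `RMV_X`. -/
abbrev RMVFree (X : Type u) : Type u := LTAlg rmvScalars X

namespace LTAlg

variable {S : ScalarSet} {X : Type u}

/-- The class of a formula. -/
def mk (φ : Formula S X) : LTAlg S X := Quotient.mk (equivSetoid S X) φ

/-- The class of a variable. -/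
def var (x : X) : LTAlg S X := mk (Formula.var x)

theorem sound {φ ψ : Formula S X} (h : Provable (Formula.imp φ ψ))
    (k : Provable (Formula.imp ψ φ)) : mk φ = mk ψ := Quotient.sound ⟨h, k⟩

theorem exact {φ ψ : Formula S X} (h : mk φ = mk ψ) :
    Provable (Formula.imp φ ψ) ∧ Provable (Formula.imp ψ φ) := Quotient.exact h

theorem sound_of_provable {φ ψ : Formula S X} (h : Provable φ) (k : Provable ψ) : mk φ = mk ψ :=
  sound (.const φ k) (.const ψ h)

@[elab_as_elim]
theorem ind {p : LTAlg S X → Prop} (h : ∀ φ, p (mk φ)) (a : LTAlg S X) : p a := Quotient.ind h a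

/-- `[φ] → [ψ] = [φ → ψ]`. -/
def imp : LTAlg S X → LTAlg S X → LTAlg S X :=
  Quotient.map₂ Formula.imp fun _ _ h _ _ k =>
    ⟨(Provable.suffix _ h.2).trans (Provable.prefix' _ k.1),
      (Provable.suffix _ h.1).trans (Provable.prefix' _ k.2)⟩

/-- `[φ]* = [¬ φ]`. -/
def neg : LTAlg S X → LTAlg S X :=
  Quotient.map Formula.neg fun _ _ h =>
    ⟨Provable.mp h.2 (Provable.contra _ _), Provable.mp h.1 (Provable.contra _ _)⟩

/-- `r [φ] = [Δ_r φ]`. -/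
def scal (r : S.Elt) : LTAlg S X → LTAlg S X :=
  Quotient.map (delta r) fun _ _ h =>
    ⟨Provable.mp (Provable.nabla_mono r (Provable.mp h.1 (Provable.contra _ _)))
        (Provable.contra _ _),
      Provable.mp (Provable.nabla_mono r (Provable.mp h.2 (Provable.contra _ _)))
        (Provable.contra _ _)⟩

theorem mk_neg_neg (φ : Formula S X) : mk (Formula.neg (Formula.neg φ)) = mk φ :=
  sound (.dne φ) (.dni φ)

theorem imp_mk (φ ψ : Formula S X) : imp (mk φ) (mk ψ) = mk (Formula.imp φ ψ) := rfl

theorem neg_mk (φ : Formula S X) : neg (mk φ) = mk (Formula.neg φ) := rfl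

theorem scal_mk (r : S.Elt) (φ : Formula S X) : scal r (mk φ) = mk (delta r φ) := rfl

theorem neg_neg' (a : LTAlg S X) : neg (neg a) = a := by
  induction a using ind with | h φ => exact mk_neg_neg φ

theorem imp_comm' (a b : LTAlg S X) : imp (neg a) b = imp (neg b) a := by
  have key : ∀ φ ψ : Formula S X, Provable (Formula.imp (Formula.imp (Formula.neg φ) ψ)
      (Formula.imp (Formula.neg ψ) φ)) := fun φ ψ =>
    (Provable.contra _ _).trans (Provable.prefix' _ (.dne φ))
  induction a using ind with | h φ =>
  induction b using ind with | h ψ => exact sound (key φ ψ) (key ψ φ)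

theorem imp_left_comm (a b c : LTAlg S X) : imp a (imp b c) = imp b (imp a c) := by
  induction a using ind with | h φ =>
  induction b using ind with | h ψ =>
  induction c using ind with | h χ => exact sound (.exch _ _ _) (.exch _ _ _)

theorem contra' (a b : LTAlg S X) : imp (neg b) (neg a) = imp a b := by
  rw [imp_comm', neg_neg']

/-- `∇_r` on the Lindenbaum-Tarski algebra. -/
theorem neg_scal_neg (r : S.Elt) (φ : Formula S X) :
    neg (scal r (neg (mk φ))) = mk (nabla r φ) := by
  change mk (Formula.neg (Formula.neg (nabla r (Formula.neg (Formula.neg φ))))) = _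
  rw [mk_neg_neg]
  exact sound (.nabla_mono r (.dne φ)) (.nabla_mono r (.dni φ))

/-- The Lindenbaum-Tarski algebra as an MV-algebra: `[φ] ⊕ [ψ] = [¬ φ → ψ]`, `[φ]* = [¬ φ]`,
`0 = [⊥]`. -/
instance : MVAlgebra (LTAlg S X) where
  oplus a b := imp (neg a) b
  neg a := neg a
  zero := mk bot
  oplus_assoc a b c := by
    rw [imp_comm' (imp (neg a) b) c, imp_left_comm, imp_comm' c b]
  oplus_comm a b := imp_comm' a b
  oplus_zero a := by
    rw [imp_comm']
    induction a using ind with | h φ =>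
    exact sound (.mp .not_bot (.assertion _ _)) (.L1 _ _)
  neg_neg := neg_neg'
  luk a b := by
    rw [neg_neg', neg_neg', neg_neg', neg_neg']
    induction a using ind with | h φ =>
    induction b using ind with | h ψ =>
    exact sound (.L3 _ _) (.L3 _ _)
  neg_zero_oplus a := by
    induction a using ind with | h φ =>
    exact sound_of_provable (.mp (.efq φ) (.suffix φ (.dne _))) .not_bot

theorem oplus_def (a b : LTAlg S X) : oplus a b = imp (neg a) b := rfl

theorem mvneg_def (a : LTAlg S X) : MVAlgebra.neg a = neg a := rfl

theorem odot_neg (a b : LTAlg S X) : odot a (MVAlgebra.neg b) = neg (imp a b) := by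
  change neg (imp (neg (neg a)) (neg (neg b))) = _
  rw [neg_neg', neg_neg']

/-- The scalar multiplication of the Lindenbaum-Tarski algebra: `r [φ] = [Δ_r φ]`. -/
instance : ScalarMVAlgebra S (LTAlg S X) where
  scal := scal
  scal_odot_neg r a b := by
    rw [odot_neg, odot_neg]
    induction a using ind with | h φ =>
    induction b using ind with | h ψ =>
    have e : scal r (neg (imp (mk φ) (mk ψ))) = neg (mk (nabla r (Formula.imp φ ψ))) := by
      rw [imp_mk, ← neg_scal_neg, neg_neg']
    have e1 : imp (scal r (mk φ)) (scal r (mk ψ))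
        = mk (nabla r (Formula.imp (Formula.neg ψ) (Formula.neg φ))) := by
      have : mk (nabla r (Formula.imp (Formula.neg ψ) (Formula.neg φ)))
          = imp (mk (nabla r (Formula.neg ψ))) (mk (nabla r (Formula.neg φ))) :=
        sound (.R1 _ _ _) (.R1' _ _ _)
      rw [this, ← contra' (scal r (mk φ))]
      simp only [scal_mk, delta, neg_mk, mk_neg_neg]
    rw [e, e1]
    congr 1
    exact sound (.nabla_mono r (.contra _ _)) (.nabla_mono r (.L4 _ _))
  sub_scal r q a := by
    rw [odot_neg, ← contra']
    induction a using ind with | h φ =>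
    simp only [scal_mk, delta, neg_mk, mk_neg_neg]
    rw [imp_mk, neg_mk]
    change neg (mk _) = neg (mk _)
    congr 1
    exact sound (.R2 _ _ _) (.R2' _ _ _)
  scal_scal r q a := by
    induction a using ind with | h φ =>
    have e : mk (nabla r (Formula.neg (delta q φ))) = mk (nabla r (nabla q (Formula.neg φ))) :=
      sound (.nabla_mono r (.dne _)) (.nabla_mono r (.dni _))
    change neg (mk (nabla r (Formula.neg (delta q φ)))) = neg (mk _)
    rw [e]
    congr 1
    exact sound (.R3 _ _ _) (.R3' _ _ _)
  one_scal h a := by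
    induction a using ind with | h φ =>
    have e : mk (nabla ⟨1, h⟩ (Formula.neg φ)) = mk (Formula.neg φ) := sound (.R4 h _) (.R4' h _)
    change neg (mk (nabla ⟨1, h⟩ (Formula.neg φ))) = _
    rw [e]
    exact mk_neg_neg φ

/-- The canonical map from `LTAlg S X` to the Lindenbaum-Tarski algebra over more scalars, which fixes
the variables. -/
def incl {S' : ScalarSet} (h : S.carrier ⊆ S'.carrier) : LTAlg S X → LTAlg S' X :=
  Quotient.map (Formula.lift h) fun _ _ k => ⟨k.1.lift h, k.2.lift h⟩

/-- `ι_X : MV_X → LTAlg S X`. Its range consists of the MV-elements. -/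
def mvIncl (S : ScalarSet) {X : Type u} : MVFree X → LTAlg S X :=
  incl (S := mvScalars) (S' := S) (Set.empty_subset S.carrier)

/-- The substitution homomorphism that sends every variable `x` to `s x`. -/
noncomputable def substHom {Y : Type v} (s : X → LTAlg S Y) : ScalarHom S (LTAlg S X) (LTAlg S Y) where
  toFun := Quotient.map (Formula.subst fun x => Quotient.out (s x))
    fun _ _ k => ⟨k.1.subst _, k.2.subst _⟩
  map_zero := rfl
  map_oplus a b := by
    induction a using ind with | h φ =>
    induction b using ind with | h ψ => rfl
  map_neg a := by induction a using ind with | h φ => rfl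
  map_scal r a := by induction a using ind with | h φ => rfl

theorem substHom_var {Y : Type v} (s : X → LTAlg S Y) (x : X) :
    (substHom s).toFun (var x) = s x := Quotient.out_eq (s x)

end LTAlg

open LTAlg

section

variable {S : ScalarSet} {X : Type u}

theorem mk_nabla (r : S.Elt) (φ : Formula S X) :
    mk (nabla r φ) = MVAlgebra.neg (ScalarMVAlgebra.scal r (MVAlgebra.neg (mk φ))) :=
  (neg_scal_neg r φ).symm

theorem mk_imp (φ ψ : Formula S X) :
    mk (Formula.imp φ ψ) = oplus (MVAlgebra.neg (mk φ)) (mk ψ) := by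
  rw [oplus_def, mvneg_def, neg_neg', imp_mk]

/-- A homomorphism on a Lindenbaum-Tarski algebra is determined by its values on the variables. -/
theorem hom_ext {B : Type v} [ScalarMVAlgebra S B] {f g : ScalarHom S (LTAlg S X) B}
    (h : ∀ x, f.toFun (var x) = g.toFun (var x)) : f = g := by
  apply ScalarHom.ext
  funext a
  induction a using ind with | h φ =>
  induction φ with
  | var x => exact h x
  | bot => exact f.map_zero.trans g.map_zero.symm
  | neg φ ih =>
    have e : mk (Formula.neg φ) = MVAlgebra.neg (mk φ) := rfl
    rw [e, f.map_neg, g.map_neg, ih]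
  | imp φ ψ ih1 ih2 =>
    rw [mk_imp, f.map_oplus, g.map_oplus, f.map_neg, g.map_neg, ih1, ih2]
  | nabla r φ ih =>
    rw [mk_nabla, f.map_neg, g.map_neg, f.map_scal, g.map_scal, f.map_neg, g.map_neg, ih]

theorem mvIncl_oplus (a b : MVFree X) :
    mvIncl S (oplus a b) = oplus (mvIncl S a) (mvIncl S b) := by
  induction a using ind with | h φ =>
  induction b using ind with | h ψ => rfl

theorem mvIncl_neg (a : MVFree X) : mvIncl S (MVAlgebra.neg a) = MVAlgebra.neg (mvIncl S a) := by
  induction a using ind with | h φ => rfl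

/-- If two homomorphisms agree on the variables up to `ι`, they commute with `ι`. -/
theorem mvIncl_comm {Y : Type v} (f : ScalarHom mvScalars (MVFree X) (MVFree Y))
    (g : ScalarHom S (LTAlg S X) (LTAlg S Y))
    (h : ∀ x, g.toFun (var x) = mvIncl S (f.toFun (var x))) (a : MVFree X) :
    g.toFun (mvIncl S a) = mvIncl S (f.toFun a) := by
  induction a using ind with | h φ =>
  induction φ with
  | var x => exact h x
  | bot =>
    have e : (mk Formula.bot : MVFree X) = zero := rfl
    rw [e, f.map_zero]
    exact g.map_zero
  | neg φ ih =>
    have e : mk (Formula.neg φ) = MVAlgebra.neg (mk φ) := rfl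
    rw [e, f.map_neg, mvIncl_neg, g.map_neg, ih, mvIncl_neg]
  | imp φ ψ ih1 ih2 =>
    rw [mk_imp, f.map_oplus, f.map_neg, mvIncl_oplus, mvIncl_neg, g.map_oplus, g.map_neg, ih1, ih2,
      mvIncl_oplus, mvIncl_neg]
  | nabla r φ _ => exact r.2.elim

end

/-! ## The categories of theories -/

/-- A finitely generated theory `(X, I)`: a set `X` of variables, and a finitely generated ideal `I`
of the Lindenbaum-Tarski algebra over `X`. -/
structure Theory (S : ScalarSet) : Type (u + 1) where
  X : Type u
  I : MVIdeal (LTAlg S X)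
  fg : I.FG

/-- An arrow `(X, I) → (Y, J)`: a homomorphism `σ` with `σ(I) ⊆ J`. -/
@[ext]
structure Theory.Hom {S : ScalarSet} (T T' : Theory.{u} S) : Type u where
  hom : ScalarHom S (LTAlg S T.X) (LTAlg S T'.X)
  map_mem : ∀ a ∈ T.I.carrier, hom.toFun a ∈ T'.I.carrier

instance (S : ScalarSet) : Category.{u} (Theory.{u} S) where
  Hom T T' := Theory.Hom T T'
  id T := ⟨ScalarHom.id S (LTAlg S T.X), fun _ h => h⟩
  comp f g := ⟨f.hom.comp g.hom, fun a h => g.map_mem _ (f.map_mem a h)⟩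

/-- The arrows `σ : (X, I) → (Y, J)` with `σ(X) ⊆ MV_Y`. -/
def mvPreserving (S : ScalarSet) : MorphismProperty (Theory.{u} S) :=
  fun T T' σ => ∀ x : T.X, σ.hom.toFun (var x) ∈ Set.range (mvIncl S (X := T'.X))

instance (S : ScalarSet) : (mvPreserving.{u} S).IsMultiplicative where
  id_mem T := fun x => ⟨var x, rfl⟩
  comp_mem {T T' T''} σ τ hσ hτ := fun x => by
    obtain ⟨a, ha⟩ := hσ x
    choose t ht using hτ
    refine ⟨(substHom t).toFun a, ?_⟩
    change _ = τ.hom.toFun (σ.hom.toFun (var x))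
    rw [← ha]
    exact (mvIncl_comm (substHom t) τ.hom (fun y => by rw [substHom_var, ht y]) a).symm

/-- `ThMV`. -/
abbrev ThMV := Theory.{u} mvScalars

/-- `ThDMV`. -/
abbrev ThDMV := Theory.{u} dmvScalars

/-- `ThDMV'`: all objects of `ThDMV`, and the arrows that preserve MV-elements. -/
abbrev ThDMV' := WideSubcategory (mvPreserving.{u} dmvScalars)

/-- The theories `(X, I)` over `RMV_X` where `I` is generated by one element of `DMV_X`. -/
def rationallyGenerated :
    ObjectProperty (WideSubcategory (mvPreserving.{u} rmvScalars)) :=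
  fun T => ∃ f : DMVFree T.obj.X,
    T.obj.I = MVIdeal.span {incl (S' := rmvScalars) (Set.subset_univ dmvScalars.carrier) f}

/-- `ThRMV'`: theories `(X, I)` where `I` is generated by one element of `DMV_X`, and the arrows
that preserve MV-elements. -/
abbrev ThRMV' := (rationallyGenerated.{u}).FullSubcategory

/-! ## The functors -/

/-- The ideal `(I]` of `LTAlg S X` generated by an ideal `I` of `MV_X`. -/
def extend (S : ScalarSet) {X : Type u} (I : MVIdeal (MVFree X)) : MVIdeal (LTAlg S X) :=
  MVIdeal.span (mvIncl S '' I.carrier)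

section

variable {S : ScalarSet} {X : Type u}

/-- The preimage of an ideal in `MV_X`. -/
def restrict (J : MVIdeal (LTAlg S X)) : MVIdeal (MVFree X) where
  carrier := {a | mvIncl S a ∈ J.carrier}
  zero_mem := J.zero_mem
  oplus_mem {a b} ha hb := by
    change mvIncl S (oplus a b) ∈ J.carrier
    rw [mvIncl_oplus]
    exact J.oplus_mem ha hb
  lower {a b} h hb := by
    refine J.lower ?_ hb
    have h' := congrArg (mvIncl S) h
    rw [mvIncl_oplus, mvIncl_neg] at h'
    exact h'

theorem extend_span (t : Set (MVFree X)) :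
    extend S (MVIdeal.span t) = MVIdeal.span (mvIncl S '' t) := by
  apply MVIdeal.ext'
  apply Set.Subset.antisymm
  · apply MVIdeal.span_le
    rintro _ ⟨a, ha, rfl⟩
    exact ha (restrict (MVIdeal.span (mvIncl S '' t)))
      fun b hb => MVIdeal.subset_span _ ⟨b, hb, rfl⟩
  · apply MVIdeal.span_le
    rintro _ ⟨a, ha, rfl⟩
    exact MVIdeal.subset_span _ ⟨a, MVIdeal.subset_span t ha, rfl⟩

theorem extend_fg {I : MVIdeal (MVFree X)} (h : I.FG) : (extend S I).FG := by
  obtain ⟨t, ht, rfl⟩ := h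
  exact ⟨mvIncl S '' t, ht.image _, extend_span t⟩

theorem extend_single {I : MVIdeal (MVFree X)} (h : I.FG) :
    ∃ a : MVFree X, extend S I = MVIdeal.span {mvIncl S a} := by
  obtain ⟨t, ht, rfl⟩ := h
  obtain ⟨a, ha⟩ := MVIdeal.exists_single ht
  refine ⟨a, ?_⟩
  have e : MVIdeal.span t = MVIdeal.span {a} := by
    apply MVIdeal.ext'
    ext x
    change (∀ I : MVIdeal (MVFree X), _) ↔ (∀ I : MVIdeal (MVFree X), _)
    simp only [ha, Set.singleton_subset_iff]
  rw [e, extend_span, Set.image_singleton]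

/-- The extension `σ_S` of a homomorphism `σ` of MV-algebras, with `σ_S(x) = σ(x)` on the
variables. -/
noncomputable def extendHom (S : ScalarSet) {Y : Type v}
    (σ : ScalarHom mvScalars (MVFree X) (MVFree Y)) : ScalarHom S (LTAlg S X) (LTAlg S Y) :=
  substHom fun x => mvIncl S (σ.toFun (var x))

theorem extendHom_var (S : ScalarSet) {Y : Type v}
    (σ : ScalarHom mvScalars (MVFree X) (MVFree Y)) (x : X) :
    (extendHom S σ).toFun (var x) = mvIncl S (σ.toFun (var x)) := substHom_var _ x

theorem extendHom_incl {Y : Type v} (σ : ScalarHom mvScalars (MVFree X) (MVFree Y))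
    (a : MVFree X) : (extendHom S σ).toFun (mvIncl S a) = mvIncl S (σ.toFun a) :=
  mvIncl_comm σ _ (extendHom_var S σ) a

/-- The preimage of an ideal under a homomorphism. -/
def comapIdeal {Y : Type v} (f : ScalarHom S (LTAlg S X) (LTAlg S Y)) (J : MVIdeal (LTAlg S Y)) :
    MVIdeal (LTAlg S X) where
  carrier := {a | f.toFun a ∈ J.carrier}
  zero_mem := by
    change f.toFun zero ∈ J.carrier
    rw [f.map_zero]; exact J.zero_mem
  oplus_mem {a b} ha hb := by
    change f.toFun (oplus a b) ∈ J.carrier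
    rw [f.map_oplus]; exact J.oplus_mem ha hb
  lower {a b} h hb := by
    refine J.lower ?_ hb
    have h' := congrArg f.toFun h
    unfold one at h'
    rw [f.map_oplus, f.map_neg, f.map_neg, f.map_zero] at h'
    exact h'

theorem extendHom_mem {Y : Type v} (σ : ScalarHom mvScalars (MVFree X) (MVFree Y))
    {I : MVIdeal (MVFree X)} {J : MVIdeal (MVFree Y)}
    (h : ∀ a ∈ I.carrier, σ.toFun a ∈ J.carrier) :
    ∀ a ∈ (extend S I).carrier, (extendHom S σ).toFun a ∈ (extend S J).carrier := by
  intro a ha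
  refine ha (comapIdeal (extendHom S σ) (extend S J)) ?_
  rintro _ ⟨b, hb, rfl⟩
  change (extendHom S σ).toFun (mvIncl S b) ∈ (extend S J).carrier
  rw [extendHom_incl]
  exact MVIdeal.subset_span _ ⟨_, h b hb, rfl⟩

end

/-- The functor `(X, I) ↦ (X, (I])` from `ThMV` to the theories over the scalars `S`, with
MV-element-preserving arrows; an arrow `σ` goes to the homomorphism that agrees with `σ` on the
variables. -/
noncomputable def extendFunctor (S : ScalarSet) :
    ThMV.{u} ⥤ WideSubcategory (mvPreserving.{u} S) where
  obj T := ⟨⟨T.X, extend S T.I, extend_fg T.fg⟩⟩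
  map {T T'} σ :=
    ⟨⟨extendHom S σ.hom, extendHom_mem σ.hom σ.map_mem⟩,
      fun x => ⟨σ.hom.toFun (var x), (extendHom_var S σ.hom x).symm⟩⟩
  map_id T := by
    apply WideSubcategory.hom_ext
    apply Theory.Hom.ext
    apply hom_ext
    intro x
    exact substHom_var _ x
  map_comp {T T' T''} σ τ := by
    apply WideSubcategory.hom_ext
    apply Theory.Hom.ext
    apply hom_ext
    intro x
    change (extendHom S _).toFun (var x)
      = (extendHom S τ.hom).toFun ((extendHom S σ.hom).toFun (var x))
    have e1 : (extendHom S σ.hom).toFun (var x) = mvIncl S (σ.hom.toFun (var x)) :=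
      substHom_var _ x
    rw [e1, extendHom_incl]
    exact substHom_var _ x

/-- The functor `𝒟𝒯 : ThMV ⥤ ThDMV'`. -/
noncomputable def DT : ThMV.{u} ⥤ ThDMV'.{u} := extendFunctor dmvScalars

theorem incl_mvIncl {S S' : ScalarSet} (h : S.carrier ⊆ S'.carrier) {X : Type u} (a : MVFree X) :
    incl h (mvIncl S a) = mvIncl S' a := by
  induction a using ind with | h φ =>
  change LTAlg.mk _ = LTAlg.mk _
  congr 1
  induction φ with
  | var x => rfl
  | bot => rfl
  | neg φ ih => exact congrArg Formula.neg ih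
  | imp φ ψ ih1 ih2 => exact congrArg₂ Formula.imp ih1 ih2
  | nabla r φ _ => exact r.2.elim

/-- The analogous functor `ThMV ⥤ ThRMV'`. -/
noncomputable def RT : ThMV.{u} ⥤ ThRMV'.{u} :=
  (rationallyGenerated.{u}).lift (extendFunctor rmvScalars) fun T => by
    obtain ⟨a, ha⟩ := extend_single (S := rmvScalars) T.fg
    refine ⟨mvIncl dmvScalars (X := T.X) a, ha.trans ?_⟩
    rw [← incl_mvIncl (S := dmvScalars) (Set.subset_univ dmvScalars.carrier) a]
    rfl

end Luk

open Luk

/-! Write ι for the canonical map from MV_X. Two facts carry the equivalence. Conservativity: ι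
reflects the order. If ι(φ) ≤ ι(ψ), soundness in [0,1] of the larger logic gives the inequality for
all valuations, and completeness of Ł returns a proof in Ł (`mvIncl_injective`). Hence the functor
is faithful. It is full as well: an arrow that sends variables to MV-elements comes from a
substitution over Ł, and since I is a principal ideal (a], membership of ι(b) in (ι(I)] means ι(b) ≤
n·ι(a), so b ≤ n·a (`mem_of_mvIncl_mem_extend`). Clearing denominators: for every rational formula φ
some positive multiple N·φ is an integral combination of truth functions of Ł, and the truncations
of such combinations are truth functions of Ł. So ψ = min(1, Nφ) is a formula of Ł with φ ≤ ψ ≤ Nφ.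
By completeness of 𝒬Ł the ideals of φ and ψ agree, and they still agree after inclusion in RMV_X
(`exists_span_incl_eq`). This gives essential surjectivity. Completeness of ℛŁ is never used.
Completeness for rational scalars (`provable_of_eval`) follows Chang. If φ is not provable, [¬φ] ≠ 0
survives in a totally ordered quotient by a prime ideal. This chain embeds in an abelian group of
pairs, an integer and a fractional part different from 1, with a pointed cone. The evaluation of φ
involves finitely many inequalities in this cone, so a rational Farkas lemma yields an additive
functional that respects them and is positive at ¬φ. Normalised at 1, it is a valuation in which φ
is not 1. Scalars need not pass to the quotient: additivity of the functional forces it to be linear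
for rational ones (`apply_map_scal`). -/

namespace Luk

open MVAlgebra

/-! ### Arithmetic and order of MV-algebras -/

namespace MVAlgebra

section Order

variable {A : Type u} [MVAlgebra A]

/-- An MV-algebra as a commutative monoid under `⊕`. -/
@[reducible]
def toAddCommMonoid (A : Type u) [MVAlgebra A] : AddCommMonoid A where
  add := oplus
  zero := zero
  add_assoc := oplus_assoc
  zero_add a := (oplus_comm _ _).trans (oplus_zero a)
  add_zero := oplus_zero
  add_comm := oplus_comm
  nsmul := @nsmulRec A ⟨zero⟩ ⟨oplus⟩
  nsmul_zero := fun _ => rfl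
  nsmul_succ := fun _ _ => rfl

/-- Truncated subtraction `x ⊖ y = x ⊙ y*`. -/
@[reducible]
def toSub (A : Type u) [MVAlgebra A] : Sub A := ⟨fun a b => odot a (neg b)⟩

attribute [local instance] toAddCommMonoid toSub

theorem oplus_eq_add (a b : A) : oplus a b = a + b := rfl

theorem neg_zero_eq_one : neg (0 : A) = one := rfl

theorem neg_one_eq_zero : neg (one : A) = 0 := neg_neg _

theorem one_add (a : A) : one + a = one := neg_zero_oplus a

theorem add_one (a : A) : a + one = one := by rw [add_comm, one_add]

theorem neg_inj {a b : A} (h : neg a = neg b) : a = b := by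
  rw [← neg_neg a, h, neg_neg]

theorem neg_add_self (a : A) : neg a + a = one := neg_oplus_self a

theorem sub_eq (a b : A) : a - b = neg (neg a + b) := by
  change neg (oplus (neg a) (neg (neg b))) = _
  rw [neg_neg]; rfl

theorem neg_sub_eq (a b : A) : neg (a - b) = neg a + b := by rw [sub_eq, neg_neg]

theorem odot_eq_sub (a b : A) : odot a b = a - neg b := by
  rw [sub_eq]; rfl

theorem odot_comm (a b : A) : odot a b = odot b a := congrArg neg (oplus_comm _ _)

theorem neg_add (a b : A) : neg (a + b) = neg a - b := by rw [sub_eq, neg_neg]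

theorem neg_odot (a b : A) : neg (odot a b) = neg a + neg b := neg_neg _

theorem sub_add_comm' (a b : A) : a - b + b = b - a + a := by
  rw [sub_eq, sub_eq]; exact luk a b

theorem le_iff_exists (a b : A) : le a b ↔ ∃ c, b = a + c := by
  constructor
  · intro h
    refine ⟨b - a, ?_⟩
    have h' : neg a + b = one := h
    rw [add_comm, ← sub_add_comm', sub_eq, h', neg_one_eq_zero, zero_add]
  · rintro ⟨c, rfl⟩
    exact le_oplus a c

/-- The natural order of an MV-algebra. -/
@[reducible]
def toPartialOrder (A : Type u) [MVAlgebra A] : PartialOrder A where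
  le := le
  le_refl := neg_oplus_self
  le_trans a b c h k := by
    obtain ⟨x, rfl⟩ := (le_iff_exists _ _).1 h
    obtain ⟨y, rfl⟩ := (le_iff_exists _ _).1 k
    exact (le_iff_exists _ _).2 ⟨x + y, add_assoc _ _ _⟩
  le_antisymm a b h k := by
    have h' : neg a + b = one := h
    have k' : neg b + a = one := k
    have := sub_add_comm' a b
    rw [sub_eq, sub_eq, h', k', neg_one_eq_zero, zero_add, zero_add] at this
    exact this.symm

attribute [local instance] toPartialOrder

theorem le_iff (a b : A) : a ≤ b ↔ neg a + b = one := Iff.rfl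

theorem orderedSub (A : Type u) [MVAlgebra A] : OrderedSub A where
  tsub_le_iff_right a b c := by
    rw [le_iff, le_iff, neg_sub_eq, add_assoc, add_comm b c]

theorem isOrderedAddMonoid (A : Type u) [MVAlgebra A] : IsOrderedAddMonoid A where
  add_le_add_left a b h c := by
    obtain ⟨x, rfl⟩ := (le_iff_exists _ _).1 h
    exact (le_iff_exists _ _).2 ⟨x, by rw [add_right_comm]⟩

theorem canonicallyOrderedAdd (A : Type u) [MVAlgebra A] : CanonicallyOrderedAdd A where
  exists_add_of_le h := (le_iff_exists _ _).1 h
  le_add_self _ b := (le_iff_exists _ _).2 ⟨b, add_comm _ _⟩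
  le_self_add _ b := (le_iff_exists _ _).2 ⟨b, rfl⟩

attribute [local instance] orderedSub isOrderedAddMonoid canonicallyOrderedAdd

theorem le_one (a : A) : a ≤ one := add_one _

theorem neg_le_neg {a b : A} (h : a ≤ b) : neg b ≤ neg a := by
  rw [le_iff] at *; rw [neg_neg, add_comm]; exact h

theorem neg_le_neg_iff {a b : A} : neg b ≤ neg a ↔ a ≤ b :=
  ⟨fun h => by simpa only [neg_neg] using neg_le_neg h, neg_le_neg⟩

theorem odot_eq_zero_iff (a b : A) : odot a b = 0 ↔ a ≤ neg b := by
  rw [odot_eq_sub, tsub_eq_zero_iff_le]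

theorem odot_le_left (a b : A) : odot a b ≤ a := by
  rw [odot_eq_sub]; exact tsub_le_self

theorem odot_le_right (a b : A) : odot a b ≤ b := by
  rw [odot_comm]; exact odot_le_left b a

theorem add_eq_one_iff (a b : A) : a + b = one ↔ neg a ≤ b := by
  rw [le_iff, neg_neg]

/-- The hypothesis says that the sum is not truncated. The Łukasiewicz axiom for a* and b then loses
one term and becomes the claim after negation. -/
theorem add_sub_self {a b : A} (h : a ≤ neg b) : a + b - b = a := by
  have e := sub_add_comm' (neg a) b
  have h0 : b - neg a = 0 := by rw [← odot_eq_sub, odot_comm]; exact (odot_eq_zero_iff a b).2 h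
  rw [h0, zero_add, sub_eq, neg_neg] at e
  rw [sub_eq, e, neg_neg]

theorem sub_neg_sub (a b : A) : neg a - neg b = b - a := by
  rw [sub_eq, sub_eq, neg_neg, add_comm]

theorem sub_le_neg (a b : A) : a - b ≤ neg b := odot_le_right a (neg b)

/-- Both sides have the same upper bounds z: write c* = (c* ⊖ b) + b and cancel b. This is
associativity in Chang's group when neither inner sum carries. -/
theorem add_odot_eq_odot_add {a b c : A} (h : odot a b = 0) (k : odot b c = 0) :
    odot (a + b) c = odot a (b + c) := by
  rw [odot_eq_zero_iff] at h k
  have e : neg c - b + b = neg c := tsub_add_cancel_of_le k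
  apply eq_of_forall_ge_iff
  intro z
  rw [odot_eq_sub, odot_eq_sub, add_comm b c, neg_add c b, tsub_le_iff_right, tsub_le_iff_right]
  conv_lhs => rw [← e, ← add_assoc, ← tsub_le_iff_right, add_sub_self h]

/-- With d = a*, multiplying by a is subtracting d. Since d ≤ b and (b ⊖ d) + c ≤ d*, adding d back
and cancelling it is exact. This is associativity when only the first inner sum carries. -/
theorem odot_add_eq_odot_add {a b c : A} (h : a + b = one) (k : odot b c = 0) :
    odot a b + c = odot a (b + c) := by
  rw [add_eq_one_iff] at h
  rw [odot_eq_zero_iff] at k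
  rw [odot_comm, odot_comm a, odot_eq_sub, odot_eq_sub]
  set d := neg a
  have e : b - d + d = b := tsub_add_cancel_of_le h
  have hc : c ≤ neg b := by rw [← neg_neg c]; exact neg_le_neg k
  have h1 : b - d + c ≤ neg d := by
    rw [← e, add_comm, neg_add] at hc
    calc b - d + c ≤ b - d + (neg d - (b - d)) := add_le_add le_rfl hc
      _ = neg d := add_tsub_cancel_of_le (sub_le_neg b d)
  have := add_sub_self h1
  rw [add_right_comm, e] at this
  exact this.symm

theorem odot_assoc (a b c : A) : odot (odot a b) c = odot a (odot b c) := by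
  apply neg_inj
  simp only [neg_odot, add_assoc]

/-- The dual of `add_odot_eq_odot_add` under negation, for the case in which both inner sums carry.
-/
theorem odot_add_eq_add_odot {a b c : A} (h : a + b = one) (k : b + c = one) :
    odot a b + c = a + odot b c := by
  have h' : odot (neg a) (neg b) = 0 := by
    apply neg_inj; rw [neg_odot, neg_neg, neg_neg]; exact h
  have k' : odot (neg b) (neg c) = 0 := by
    apply neg_inj; rw [neg_odot, neg_neg, neg_neg]; exact k
  apply neg_inj
  rw [neg_add, neg_add]
  change odot (neg (odot a b)) (neg c) = odot (neg a) (neg (odot b c))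
  rw [neg_odot, neg_odot]
  exact add_odot_eq_odot_add h' k'

/-- Shows that a ⊖ (a ⊖ b) acts as the meet of a and b. -/
theorem le_sub_sub {a b w : A} (ha : w ≤ a) (hb : w ≤ b) : w ≤ a - (a - b) := by
  rw [← neg_le_neg_iff, neg_sub_eq, ← sub_neg_sub, add_comm]
  calc neg b - neg a + neg a ≤ neg w - neg a + neg a :=
        add_le_add (tsub_le_tsub_right (neg_le_neg hb) _) le_rfl
    _ = neg w := tsub_add_cancel_of_le (neg_le_neg ha)

/-- Prelinearity: the meet of `a ⊖ b` and `b ⊖ a` is `0`. -/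
theorem eq_zero_of_le_sub_of_le_sub {a b z : A} (h : z ≤ a - b) (k : z ≤ b - a) : z = 0 := by
  set c := a - (a - b) with hc
  have ha : c + (a - b) = a := tsub_add_cancel_of_le tsub_le_self
  have hcb : c ≤ b := by
    rw [hc, tsub_le_iff_right, add_comm]; exact le_tsub_add
  have hb : c + (b - a) = b := by
    have : c = b - (b - a) := by
      apply neg_inj
      rw [hc, neg_sub_eq, neg_sub_eq, ← sub_neg_sub, ← sub_neg_sub a b, add_comm, sub_add_comm',
        add_comm]
    rw [this]
    exact tsub_add_cancel_of_le tsub_le_self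
  -- Adding z to the meet c stays below a and b, so below c. As z ≤ c*, the c can be cancelled, and
  -- z = 0.
  have h1 : c + z ≤ c :=
    le_sub_sub ((add_le_add le_rfl h).trans ha.le) ((add_le_add le_rfl k).trans hb.le)
  have h2 : z ≤ neg c := h.trans ((sub_le_neg a b).trans (neg_le_neg hcb))
  have h3 := add_sub_self h2
  rw [add_comm] at h3
  rw [← h3]
  exact tsub_eq_zero_of_le h1

/-- If w ≤ y + z, then w ⊖ z lies below x and y, hence is 0, so w ≤ z. -/
theorem eq_zero_of_disjoint_add {x y z : A} (hy : ∀ w, w ≤ x → w ≤ y → w = 0)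
    (hz : ∀ w, w ≤ x → w ≤ z → w = 0) (w : A) (h : w ≤ x) (k : w ≤ y + z) : w = 0 := by
  have h1 : w - z = 0 := hy _ (tsub_le_self.trans h) (tsub_le_iff_right.2 k)
  exact hz _ h (tsub_eq_zero_iff_le.1 h1)

theorem eq_zero_of_disjoint_nsmul {x y : A} (hy : ∀ w, w ≤ x → w ≤ y → w = 0) (n : ℕ) (w : A)
    (h : w ≤ x) (k : w ≤ n • y) : w = 0 := by
  induction n generalizing w with
  | zero => rw [zero_smul] at k; exact nonpos_iff_eq_zero.1 k
  | succ n ih =>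
    rw [succ_nsmul] at k
    exact eq_zero_of_disjoint_add ih hy w h k

theorem eq_zero_of_le_nsmul_sub (a b w : A) (m n : ℕ) (h : w ≤ m • (a - b))
    (k : w ≤ n • (b - a)) : w = 0 :=
  eq_zero_of_disjoint_nsmul (fun w' h' k' =>
    eq_zero_of_disjoint_nsmul (fun _ h'' k'' => eq_zero_of_le_sub_of_le_sub k'' h'') m w' k' h')
    n w h k

end Order

end MVAlgebra

/-! ### Chang's group of a totally ordered MV-algebra -/

/-- Totally ordered nontrivial MV-algebras. -/
class MVChain (A : Type u) extends MVAlgebra A where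
  total : ∀ a b : A, le a b ∨ le b a
  one_ne_zero : (one : A) ≠ zero

section

attribute [local instance] toAddCommMonoid toSub toPartialOrder orderedSub isOrderedAddMonoid
  canonicallyOrderedAdd

variable {A : Type u} [MVChain A]

theorem MVChain.odot_eq_zero {a b : A} (h : a + b ≠ one) : odot a b = 0 := by
  rw [odot_eq_zero_iff]
  refine (MVChain.total a (neg b)).resolve_right fun k => h ?_
  rw [add_comm, add_eq_one_iff]
  exact k

theorem MVAlgebra.odot_ne_one {a b : A} (h : a ≠ one) : odot a b ≠ one := fun e =>
  h (le_antisymm (le_one a) (e ▸ odot_le_left a b))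

/-- Chang's group of a totally ordered MV-algebra. The pair `(m, a)` stands for `m · 1 + a`. -/
@[ext]
structure ChangGroup (A : Type u) [MVChain A] where
  int : ℤ
  frac : A
  frac_ne : frac ≠ one

namespace ChangGroup

open Classical in
/-- Addition with carry. -/
noncomputable def add (x y : ChangGroup A) : ChangGroup A :=
  if h : x.frac + y.frac = one then ⟨x.int + y.int + 1, odot x.frac y.frac, odot_ne_one x.frac_ne⟩
  else ⟨x.int + y.int, x.frac + y.frac, h⟩

noncomputable instance : Add (ChangGroup A) := ⟨add⟩

theorem add_carry {x y : ChangGroup A} (h : x.frac + y.frac = one) :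
    x + y = ⟨x.int + y.int + 1, odot x.frac y.frac, odot_ne_one x.frac_ne⟩ := dif_pos h

theorem add_no_carry {x y : ChangGroup A} (h : x.frac + y.frac ≠ one) :
    x + y = ⟨x.int + y.int, x.frac + y.frac, h⟩ := dif_neg h

theorem zero_ne_one : (0 : A) ≠ one := MVChain.one_ne_zero.symm

instance : Zero (ChangGroup A) := ⟨⟨0, 0, zero_ne_one⟩⟩

theorem int_zero : (0 : ChangGroup A).int = 0 := rfl

theorem frac_zero : (0 : ChangGroup A).frac = 0 := rfl

protected theorem add_comm (x y : ChangGroup A) : x + y = y + x := by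
  by_cases h : x.frac + y.frac = one
  · rw [add_carry h, add_carry (by rwa [_root_.add_comm])]
    ext
    · exact congrArg (· + 1) (_root_.add_comm _ _)
    · exact odot_comm _ _
  · rw [add_no_carry h, add_no_carry (by rwa [_root_.add_comm])]
    ext
    · exact _root_.add_comm _ _
    · exact _root_.add_comm _ _

theorem add_assoc_of_carry_left {x y z : ChangGroup A} (h : x.frac + y.frac = one)
    (k : y.frac + z.frac ≠ one) : x + y + z = x + (y + z) := by
  have e := odot_add_eq_odot_add h (MVChain.odot_eq_zero k)
  have h1 : odot x.frac y.frac + z.frac ≠ one := by rw [e]; exact odot_ne_one x.frac_ne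
  have h2 : x.frac + (y.frac + z.frac) = one := by rw [← add_assoc, h, one_add]
  rw [add_carry h, add_no_carry k, add_no_carry h1, add_carry h2]
  ext
  · dsimp only; ring
  · exact e

/-- The carries of x + y and y + z give four cases, each settled by one identity between ⊕ and ⊙;
the two mixed cases are mirror images. -/
protected theorem add_assoc (x y z : ChangGroup A) : x + y + z = x + (y + z) := by
  by_cases h : x.frac + y.frac = one <;> by_cases k : y.frac + z.frac = one
  · have e := odot_add_eq_add_odot h k
    rw [add_carry h, add_carry k]
    by_cases h1 : odot x.frac y.frac + z.frac = one
    · rw [add_carry h1, add_carry (e ▸ h1)]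
      ext
      · dsimp only; ring
      · exact odot_assoc _ _ _
    · rw [add_no_carry h1, add_no_carry (e ▸ h1)]
      ext
      · dsimp only; ring
      · exact e
  · exact add_assoc_of_carry_left h k
  · rw [ChangGroup.add_comm (x + y), ChangGroup.add_comm x (y + z), ChangGroup.add_comm x y,
      ChangGroup.add_comm y z]
    exact (add_assoc_of_carry_left (by rwa [_root_.add_comm]) (by rwa [_root_.add_comm])).symm
  · have e := add_odot_eq_odot_add (MVChain.odot_eq_zero h) (MVChain.odot_eq_zero k)
    rw [add_no_carry h, add_no_carry k]
    by_cases h1 : x.frac + y.frac + z.frac = one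
    · rw [add_carry h1, add_carry (by rwa [← add_assoc])]
      ext
      · dsimp only; ring
      · exact e
    · rw [add_no_carry h1, add_no_carry (by rwa [← add_assoc])]
      ext
      · exact add_assoc _ _ _
      · exact add_assoc _ _ _

protected theorem zero_add (x : ChangGroup A) : 0 + x = x := by
  have h : (0 : ChangGroup A).frac + x.frac ≠ one := by
    rw [frac_zero, zero_add]; exact x.frac_ne
  rw [add_no_carry h]
  ext
  · exact zero_add _
  · exact zero_add _

theorem neg_ne_one {a : A} (h : a ≠ 0) : neg a ≠ one := fun e =>
  h (neg_inj (e.trans neg_zero_eq_one.symm))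

open Classical in
noncomputable instance : Neg (ChangGroup A) :=
  ⟨fun x => if h : x.frac = 0 then ⟨-x.int, 0, zero_ne_one⟩
    else ⟨-x.int - 1, neg x.frac, neg_ne_one h⟩⟩

protected theorem neg_add_cancel (x : ChangGroup A) : -x + x = 0 := by
  by_cases h : x.frac = 0
  · have e : -x = ⟨-x.int, 0, zero_ne_one⟩ := dif_pos h
    rw [e, add_no_carry (by dsimp only; rw [zero_add]; exact x.frac_ne)]
    ext
    · exact neg_add_cancel _
    · exact (zero_add _).trans h
  · have e : -x = ⟨-x.int - 1, neg x.frac, neg_ne_one h⟩ := dif_neg h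
    rw [e, add_carry (neg_add_self _)]
    ext
    · dsimp only; rw [int_zero]; ring
    · exact (odot_eq_zero_iff _ _).2 le_rfl

noncomputable instance : AddCommGroup (ChangGroup A) where
  add_assoc := ChangGroup.add_assoc
  zero_add := ChangGroup.zero_add
  add_zero x := (ChangGroup.add_comm _ _).trans (ChangGroup.zero_add x)
  nsmul := nsmulRec
  zsmul := zsmulRec
  neg_add_cancel := ChangGroup.neg_add_cancel
  add_comm := ChangGroup.add_comm

theorem int_add_nonneg {x y : ChangGroup A} (hx : 0 ≤ x.int) (hy : 0 ≤ y.int) :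
    0 ≤ (x + y).int := by
  by_cases h : x.frac + y.frac = one
  · rw [add_carry h]; dsimp only; omega
  · rw [add_no_carry h]; dsimp only; omega

theorem eq_zero_of_add_eq_zero {x y : ChangGroup A} (hx : 0 ≤ x.int) (hy : 0 ≤ y.int)
    (e : x + y = 0) : x = 0 := by
  by_cases h : x.frac + y.frac = one
  · rw [add_carry h] at e
    have := congrArg int e
    rw [int_zero] at this
    dsimp only at this; omega
  · rw [add_no_carry h] at e
    have h1 := congrArg int e
    have h2 := congrArg frac e
    rw [int_zero] at h1
    rw [frac_zero] at h2
    dsimp only at h1 h2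
    ext
    · rw [int_zero]; omega
    · exact (add_eq_zero.1 h2).1

open Classical in
/-- The embedding of the MV-algebra in its Chang group. -/
noncomputable def of (a : A) : ChangGroup A :=
  if h : a = one then ⟨1, 0, zero_ne_one⟩ else ⟨0, a, h⟩

theorem of_one : of (one : A) = ⟨1, 0, zero_ne_one⟩ := dif_pos rfl

theorem of_ne {a : A} (h : a ≠ one) : of a = ⟨0, a, h⟩ := dif_neg h

theorem of_zero : of (0 : A) = 0 := of_ne zero_ne_one

theorem of_int_nonneg (a : A) : 0 ≤ (of a).int := by
  by_cases h : a = one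
  · rw [h, of_one]; exact zero_le_one
  · rw [of_ne h]

theorem of_ne_zero {a : A} (h : a ≠ 0) : of a ≠ 0 := by
  intro e
  by_cases k : a = one
  · rw [k, of_one] at e
    exact one_ne_zero (congrArg int e)
  · rw [of_ne k] at e
    exact h (congrArg frac e)

/-- The excess of a sum over 1 is a ⊙ b. The cases a = 1 and b = 1 are separate because 1 is not a
fractional part. -/
theorem of_add_of_carry {a b : A} (h : a + b = one) : of a + of b = of one + of (odot a b) := by
  by_cases ha : a = one
  · rw [ha]
    have : odot one b = b := by rw [odot_comm, odot_eq_sub, neg_one_eq_zero, tsub_zero]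
    rw [this]
  by_cases hb : b = one
  · rw [hb, _root_.add_comm]
    have : odot a one = a := by rw [odot_eq_sub, neg_one_eq_zero, tsub_zero]
    rw [this]
  have ho : odot a b ≠ one := odot_ne_one ha
  rw [of_ne ha, of_ne hb, of_ne ho, of_one, add_carry h, add_no_carry (by simpa using ho)]
  ext
  · dsimp only; ring
  · exact (zero_add _).symm

theorem of_add_of_odot_eq_zero {a b : A} (h : odot a b = 0) : of (a + b) = of a + of b := by
  by_cases k : a + b = one
  · rw [of_add_of_carry k, k, h, of_zero, add_zero]
  · have ha : a ≠ one := fun e => k (by rw [e, one_add])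
    have hb : b ≠ one := fun e => k (by rw [e, add_one])
    rw [of_ne ha, of_ne hb, of_ne k, add_no_carry k]
    ext
    · exact (zero_add _).symm
    · rfl

end ChangGroup

end

/-! ### Prime ideals, totally ordered quotients and maps to groups -/

section

attribute [local instance] toAddCommMonoid toSub toPartialOrder orderedSub isOrderedAddMonoid
  canonicallyOrderedAdd

variable {A : Type u} [MVAlgebra A]

namespace MVIdeal

theorem add_mem (I : MVIdeal A) {x y : A} (hx : x ∈ I.carrier) (hy : y ∈ I.carrier) :
    x + y ∈ I.carrier := I.oplus_mem hx hy

theorem mem_of_le (I : MVIdeal A) {x y : A} (h : x ≤ y) (hy : y ∈ I.carrier) :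
    x ∈ I.carrier := I.lower h hy

theorem nsmul_mem (I : MVIdeal A) {x : A} (hx : x ∈ I.carrier) (n : ℕ) : n • x ∈ I.carrier := by
  induction n with
  | zero => rw [zero_smul]; exact I.zero_mem
  | succ n ih => rw [succ_nsmul]; exact I.add_mem ih hx

/-- The ideal generated by `I` and one more element. -/
def adjoin (I : MVIdeal A) (a : A) : MVIdeal A where
  carrier := {x | ∃ p ∈ I.carrier, ∃ n : ℕ, x ≤ p + n • a}
  zero_mem := ⟨0, I.zero_mem, 0, zero_le⟩
  oplus_mem {x y} := by
    rintro ⟨p, hp, m, hm⟩ ⟨q, hq, n, hn⟩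
    refine ⟨p + q, I.add_mem hp hq, m + n, ?_⟩
    rw [add_nsmul, add_add_add_comm]
    exact add_le_add hm hn
  lower {x y} h := by
    rintro ⟨p, hp, m, hm⟩
    exact ⟨p, hp, m, le_trans h hm⟩

theorem subset_adjoin (I : MVIdeal A) (a : A) : I.carrier ⊆ (I.adjoin a).carrier :=
  fun p hp => ⟨p, hp, 0, le_self_add⟩

theorem mem_adjoin (I : MVIdeal A) (a : A) : a ∈ (I.adjoin a).carrier :=
  ⟨0, I.zero_mem, 1, by rw [one_smul, zero_add]⟩

theorem mem_span_singleton (a x : A) :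
    x ∈ (span {a}).carrier ↔ ∃ n : ℕ, x ≤ n • a := by
  constructor
  · intro h
    let Z : MVIdeal A :=
      { carrier := {x | ∃ n : ℕ, x ≤ n • a}
        zero_mem := ⟨0, zero_le⟩
        oplus_mem := by
          rintro x y ⟨m, hm⟩ ⟨n, hn⟩
          exact ⟨m + n, by rw [add_nsmul]; exact add_le_add hm hn⟩
        lower := by
          rintro x y h ⟨m, hm⟩
          exact ⟨m, le_trans h hm⟩ }
    exact h Z (Set.singleton_subset_iff.2 ⟨1, by rw [one_smul]⟩)
  · rintro ⟨n, hn⟩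
    exact mem_of_le _ hn (nsmul_mem _ (subset_span _ (Set.mem_singleton a)) n)

/-- Prime ideals. -/
def Prime (I : MVIdeal A) : Prop := ∀ a b : A, a - b ∈ I.carrier ∨ b - a ∈ I.carrier

/-- Take an ideal maximal among those avoiding a₀. If it contained neither a ⊖ b nor b ⊖ a, then
modulo I the element a₀ would lie below multiples of both. Such multiples are disjoint, so a₀ would
lie in I. -/
theorem exists_prime {a₀ : A} (h : a₀ ≠ 0) : ∃ I : MVIdeal A, I.Prime ∧ a₀ ∉ I.carrier := by
  obtain ⟨M, -, hM⟩ := zorn_subset_nonempty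
    {s : Set A | ∃ I : MVIdeal A, I.carrier = s ∧ a₀ ∉ s} (by
      rintro c hc hchain ⟨s₀, hs₀⟩
      have hz : ∀ s ∈ c, zero ∈ s := fun s hs => by
        obtain ⟨I, rfl, -⟩ := hc hs; exact I.zero_mem
      refine ⟨⋃₀ c, ⟨⟨⋃₀ c, ⟨s₀, hs₀, hz _ hs₀⟩, ?_, ?_⟩, rfl, ?_⟩,
        fun s hs => Set.subset_sUnion_of_mem hs⟩
      · rintro x y ⟨s, hs, hx⟩ ⟨t, ht, hy⟩
        rcases hchain.total hs ht with k | k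
        · obtain ⟨I, rfl, -⟩ := hc ht
          exact ⟨_, ht, I.oplus_mem (k hx) hy⟩
        · obtain ⟨I, rfl, -⟩ := hc hs
          exact ⟨_, hs, I.oplus_mem hx (k hy)⟩
      · rintro x y k ⟨s, hs, hy⟩
        obtain ⟨I, rfl, -⟩ := hc hs
        exact ⟨_, hs, I.lower k hy⟩
      · rintro ⟨s, hs, k⟩
        obtain ⟨-, -, k'⟩ := hc hs
        exact k' k)
    {0} ⟨⟨{0}, rfl, fun hx hy => by
        rw [Set.mem_singleton_iff] at *; rw [hx, hy]; exact add_zero 0,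
      fun k hy => by
        rw [Set.mem_singleton_iff] at *; subst hy; exact nonpos_iff_eq_zero.1 k⟩, rfl, h⟩
  obtain ⟨⟨I, rfl, hI⟩, hmax⟩ := hM
  refine ⟨I, fun a b => ?_, hI⟩
  have key : ∀ c, c ∉ I.carrier → a₀ ∈ (I.adjoin c).carrier := fun c hc => by
    by_contra k
    exact hc (hmax ⟨I.adjoin c, rfl, k⟩ (I.subset_adjoin c) (I.mem_adjoin c))
  by_contra! k
  obtain ⟨p, hp, m, hm⟩ := key _ k.1
  obtain ⟨q, hq, n, hn⟩ := key _ k.2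
  refine hI (I.mem_of_le ?_ (I.add_mem hp hq))
  rw [← tsub_eq_zero_iff_le]
  -- The remainder a₀ ⊖ (p + q) is below both multiples.
  refine eq_zero_of_le_nsmul_sub a b _ m n ?_ ?_
  · rw [tsub_le_iff_left]
    exact hm.trans (add_le_add le_self_add le_rfl)
  · rw [tsub_le_iff_left]
    exact hn.trans (add_le_add le_add_self le_rfl)

/-- Congruence modulo an ideal. -/
def setoid (I : MVIdeal A) : Setoid A where
  r a b := a - b ∈ I.carrier ∧ b - a ∈ I.carrier
  iseqv := ⟨fun a => by rw [tsub_self]; exact ⟨I.zero_mem, I.zero_mem⟩, fun h => ⟨h.2, h.1⟩,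
    fun {a b c} h k => ⟨I.mem_of_le tsub_le_tsub_add_tsub (I.add_mem h.1 k.1),
      I.mem_of_le tsub_le_tsub_add_tsub (I.add_mem k.2 h.2)⟩⟩

theorem add_sub_add_mem (I : MVIdeal A) {a b c d : A} (h : a - b ∈ I.carrier)
    (k : c - d ∈ I.carrier) : a + c - (b + d) ∈ I.carrier :=
  I.mem_of_le add_tsub_add_le_tsub_add_tsub (I.add_mem h k)

/-- The quotient of an MV-algebra by an ideal. -/
def Quot (I : MVIdeal A) : Type u := Quotient I.setoid

namespace Quot

variable (I : MVIdeal A)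

/-- The class of an element. -/
def mk (a : A) : I.Quot := Quotient.mk I.setoid a

theorem mk_eq_zero_iff (a : A) : mk I a = mk I 0 ↔ a ∈ I.carrier := by
  constructor
  · intro h
    have h' : a - 0 ∈ I.carrier ∧ 0 - a ∈ I.carrier := Quotient.exact h
    rw [tsub_zero] at h'
    exact h'.1
  · intro h
    refine Quotient.sound (show a - 0 ∈ I.carrier ∧ 0 - a ∈ I.carrier from ?_)
    rw [tsub_zero, zero_tsub]
    exact ⟨h, I.zero_mem⟩

instance : MVAlgebra I.Quot where
  oplus := Quotient.map₂ oplus fun _ _ h _ _ k =>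
    ⟨I.add_sub_add_mem h.1 k.1, I.add_sub_add_mem h.2 k.2⟩
  neg := Quotient.map neg fun a b h =>
    (show neg a - neg b ∈ I.carrier ∧ neg b - neg a ∈ I.carrier by
      rw [sub_neg_sub, sub_neg_sub]; exact ⟨h.2, h.1⟩)
  zero := mk I 0
  oplus_assoc := by
    rintro ⟨a⟩ ⟨b⟩ ⟨c⟩; exact congrArg (mk I) (oplus_assoc a b c)
  oplus_comm := by rintro ⟨a⟩ ⟨b⟩; exact congrArg (mk I) (oplus_comm a b)
  oplus_zero := by rintro ⟨a⟩; exact congrArg (mk I) (oplus_zero a)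
  neg_neg := by rintro ⟨a⟩; exact congrArg (mk I) (neg_neg a)
  luk := by rintro ⟨a⟩ ⟨b⟩; exact congrArg (mk I) (luk a b)
  neg_zero_oplus := by rintro ⟨a⟩; exact congrArg (mk I) (neg_zero_oplus a)

theorem mk_add (a b : A) : mk I (a + b) = mk I a + mk I b := rfl

theorem mk_one : mk I one = one := rfl

theorem mk_odot (a b : A) : mk I (odot a b) = odot (mk I a) (mk I b) := rfl

theorem mk_sub (a b : A) : mk I (a - b) = mk I a - mk I b := rfl

/-- The quotient by a proper prime ideal is totally ordered. -/
@[reducible]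
def toMVChain (hI : I.Prime) {a₀ : A} (h : a₀ ∉ I.carrier) : MVChain I.Quot where
  total := by
    rintro ⟨a⟩ ⟨b⟩
    have e : ∀ a b : A, a - b ∈ I.carrier → mk I a ≤ mk I b := fun a b k => by
      rw [← tsub_eq_zero_iff_le, ← mk_sub]
      exact (mk_eq_zero_iff I _).2 k
    exact (hI a b).imp (e a b) (e b a)
  one_ne_zero k := h (I.mem_of_le (le_one a₀) ((mk_eq_zero_iff I _).1 k))

end Quot

end MVIdeal

/-- A map from an MV-algebra to an abelian group with a pointed cone that turns `⊕` into truncated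
addition. -/
structure GroupState (A : Type u) [MVAlgebra A] where
  G : Type u
  [group : AddCommGroup G]
  pos : AddSubmonoid G
  eq_zero_of_add : ∀ x ∈ pos, ∀ y ∈ pos, x + y = 0 → x = 0
  map : A → G
  map_mem : ∀ a, map a ∈ pos
  map_zero : map 0 = 0
  map_add_of_le : ∀ a b : A, a ≤ neg b → map (a + b) = map a + map b
  map_add : ∀ a b : A, map (a + b) = map a + map b ∨
    map (a + b) = map one ∧ map a + map b - map one ∈ pos

attribute [instance] GroupState.group

/-- Compose the quotient by a prime ideal avoiding a₀ with the embedding in Chang's group; the cone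
consists of the pairs with nonnegative integer part. -/
theorem exists_groupState {a₀ : A} (h : a₀ ≠ 0) : ∃ s : GroupState A, s.map a₀ ≠ 0 := by
  obtain ⟨I, hI, hI₀⟩ := MVIdeal.exists_prime h
  let _ := MVIdeal.Quot.toMVChain I hI hI₀
  let pos : AddSubmonoid (ChangGroup I.Quot) :=
    { carrier := {x | 0 ≤ x.int}
      zero_mem' := le_refl (0 : ℤ)
      add_mem' := ChangGroup.int_add_nonneg }
  refine ⟨⟨ChangGroup I.Quot, pos, fun x hx y hy => ChangGroup.eq_zero_of_add_eq_zero hx hy,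
    fun a => .of (MVIdeal.Quot.mk I a), fun a => ChangGroup.of_int_nonneg _, ChangGroup.of_zero,
    fun a b k => ?_, fun a b => ?_⟩, ?_⟩
  · rw [MVIdeal.Quot.mk_add]
    refine ChangGroup.of_add_of_odot_eq_zero ?_
    rw [← MVIdeal.Quot.mk_odot, (odot_eq_zero_iff a b).2 k]
    rfl
  · rw [MVIdeal.Quot.mk_add]
    by_cases k : MVIdeal.Quot.mk I a + MVIdeal.Quot.mk I b = one
    · right
      rw [ChangGroup.of_add_of_carry k, k, MVIdeal.Quot.mk_one, add_sub_cancel_left]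
      exact ⟨rfl, ChangGroup.of_int_nonneg _⟩
    · exact Or.inl (ChangGroup.of_add_of_odot_eq_zero (MVChain.odot_eq_zero k))
  · exact ChangGroup.of_ne_zero fun e => hI₀ ((MVIdeal.Quot.mk_eq_zero_iff I _).1 e)

end

/-! ### Farkas' lemma and rational functionals on pointed cones -/

/-- A form of Farkas' lemma over an ordered field. -/
theorem exists_nonneg_combination_or_functional {K ι V : Type*} [Field K] [LinearOrder K]
    [IsStrictOrderedRing K] [AddCommGroup V] [Module K V] (s : Finset ι) (v : ι → V) (q : V) :
    (∃ c : ι → K, (∀ i, 0 ≤ c i) ∧ q = ∑ i ∈ s, c i • v i) ∨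
      ∃ θ : V →ₗ[K] K, (∀ i ∈ s, 0 ≤ θ (v i)) ∧ θ q < 0 := by
  classical
  induction s using Finset.induction_on generalizing v q with
  | empty =>
    by_cases hq : q = 0
    · exact Or.inl ⟨0, fun _ => le_rfl, by simpa using hq⟩
    · obtain ⟨θ, hθ⟩ : ∃ θ : Module.Dual K V, θ q ≠ 0 := by
        by_contra! h
        exact hq ((Module.forall_dual_apply_eq_zero_iff K q).1 h)
      refine Or.inr ?_
      rcases lt_or_gt_of_ne hθ with h | h
      · exact ⟨θ, by simp, h⟩
      · exact ⟨-θ, by simp, by simpa using h⟩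
  | insert j s hj ih =>
    rcases ih v q with ⟨c, hc, e⟩ | ⟨θ, hθ, hq⟩
    · refine Or.inl ⟨Function.update c j 0, fun i => ?_, ?_⟩
      · by_cases h : i = j
        · subst h; simp
        · simpa [h] using hc i
      · rw [Finset.sum_insert hj, e]
        simp only [Function.update_self, zero_smul, zero_add]
        refine Finset.sum_congr rfl fun i hi => ?_
        rw [Function.update_of_ne (ne_of_mem_of_not_mem hi hj)]
    by_cases hp : 0 ≤ θ (v j)
    · refine Or.inr ⟨θ, fun i hi => ?_, hq⟩
      rcases Finset.mem_insert.1 hi with rfl | hi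
      exacts [hp, hθ i hi]
    push Not at hp
    let t : V → K := fun x => θ x / θ (v j)
    -- The projection onto ker θ along `v j`. The induction hypothesis is used again on the
    -- projected vectors.
    let pr : V →ₗ[K] V := LinearMap.id - ((θ (v j))⁻¹ • θ).smulRight (v j)
    have hpr : ∀ x, pr x = x - t x • v j := fun x => by
      simp [pr, t, div_eq_inv_mul]
    have htj : t (v j) = 1 := div_self hp.ne
    rcases ih (fun i => pr (v i)) (pr q) with ⟨c, hc, e⟩ | ⟨η, hη, hηq⟩
    · left
      -- The coefficient of `v j` undoes the projection. It is nonnegative: θ is negative at q and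
      -- `v j` and nonnegative at the other vectors, so t q ≥ 0 and t (v i) ≤ 0.
      refine ⟨Function.update c j (t q - ∑ i ∈ s, c i * t (v i)), fun i => ?_, ?_⟩
      · by_cases h : i = j
        · subst h
          rw [Function.update_self]
          have h1 : 0 ≤ t q := div_nonneg_of_nonpos hq.le hp.le
          have h2 : ∑ k ∈ s, c k * t (v k) ≤ 0 := Finset.sum_nonpos fun k hk =>
            mul_nonpos_of_nonneg_of_nonpos (hc k) (div_nonpos_of_nonneg_of_nonpos (hθ k hk) hp.le)
          linarith
        · simpa [h] using hc i
      · rw [Finset.sum_insert hj, Function.update_self]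
        have e1 : ∑ i ∈ s, Function.update c j (t q - ∑ i ∈ s, c i * t (v i)) i • v i
            = ∑ i ∈ s, c i • v i := Finset.sum_congr rfl fun i hi => by
          rw [Function.update_of_ne (ne_of_mem_of_not_mem hi hj)]
        rw [e1]
        rw [hpr, sub_eq_iff_eq_add] at e
        refine e.trans ?_
        simp only [hpr, smul_sub, Finset.sum_sub_distrib, sub_smul, Finset.sum_smul, mul_smul]
        abel
    -- The composite vanishes at `v j`.
    · refine Or.inr ⟨η ∘ₗ pr, fun i hi => ?_, hηq⟩
      rcases Finset.mem_insert.1 hi with rfl | hi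
      · simp [hpr, htj]
      · exact hη i hi

theorem exists_nat_mul_eq_natCast {ι : Type*} (s : Finset ι) (c : ι → ℚ) (hc : ∀ i, 0 ≤ c i) :
    ∃ N : ℕ, 0 < N ∧ ∀ i ∈ s, ∃ n : ℕ, N * c i = n := by
  refine ⟨∏ i ∈ s, (c i).den, Finset.prod_pos fun i _ => (c i).pos, fun i hi => ?_⟩
  obtain ⟨k, hk⟩ := Finset.dvd_prod_of_mem (fun i => (c i).den) hi
  refine ⟨k * (c i).num.toNat, ?_⟩
  rw [hk]
  have h1 : ((c i).num.toNat : ℚ) = (c i).num := by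
    exact_mod_cast Int.toNat_of_nonneg (Rat.num_nonneg.2 (hc i))
  push_cast
  rw [h1, mul_comm ((c i).den : ℚ), mul_assoc, mul_comm ((c i).den : ℚ), Rat.mul_den_eq_num]

open TensorProduct in
/-- A finite subset of a pointed cone of an abelian group can be made nonnegative by a rational
functional that is positive at a given nonzero element of the cone. -/
theorem exists_addMonoidHom_rat {G : Type*} [AddCommGroup G] (pos : AddSubmonoid G)
    (hpos : ∀ x ∈ pos, ∀ y ∈ pos, x + y = 0 → x = 0) (s : Finset G) (hs : ∀ x ∈ s, x ∈ pos)
    {q : G} (hq : q ∈ pos) (hq0 : q ≠ 0) :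
    ∃ θ : G →+ ℚ, (∀ x ∈ s, 0 ≤ θ x) ∧ 0 < θ q := by
  let f : G →ₗ[ℤ] ℚ ⊗[ℤ] G := TensorProduct.mk ℤ ℚ G 1
  -- If −q were a nonnegative rational combination of s, clearing denominators would make a positive
  -- multiple of q plus a cone element vanish, against pointedness.
  rcases exists_nonneg_combination_or_functional (K := ℚ) s f (-f q) with ⟨c, hc, e⟩ | ⟨θ, h, h'⟩
  · exfalso
    obtain ⟨N, hN, hn⟩ := exists_nat_mul_eq_natCast s c hc
    choose! n hn using hn
    have e1 : f (N • q + ∑ x ∈ s, n x • x) = f 0 := by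
      have e2 := congrArg ((N : ℚ) • ·) e
      simp only [Finset.smul_sum, smul_smul] at e2
      rw [Finset.sum_congr rfl fun x hx => by rw [hn x hx]] at e2
      simp only [Nat.cast_smul_eq_nsmul] at e2
      simp only [map_add, map_nsmul, map_sum, map_zero]
      rw [← e2, smul_neg, add_neg_cancel]
    -- The kernel of G → ℚ ⊗ G is torsion, so the equation holds in G after multiplication by some m
    -- ≠ 0.
    have : IsLocalizedModule (nonZeroDivisors ℤ) f :=
      IsLocalization.tensorProduct_isLocalizedModule _ _
    obtain ⟨⟨m, hm⟩, e2⟩ :=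
      (IsLocalizedModule.eq_iff_exists (nonZeroDivisors ℤ) f).1 e1
    have hm0 : m ≠ 0 := nonZeroDivisors.ne_zero hm
    have e3 : m.natAbs • (N • q + ∑ x ∈ s, n x • x) = 0 := by
      have e4 : m • (N • q + ∑ x ∈ s, n x • x) = 0 := e2.trans (smul_zero _)
      rcases Int.natAbs_eq m with h | h
      · rw [← natCast_zsmul, ← h, e4]
      · rw [← neg_eq_zero, ← natCast_zsmul, ← neg_smul, ← h, e4]
    -- One copy of q is split off; all the rest lies in the cone.
    obtain ⟨k, hk⟩ : ∃ k, m.natAbs * N = k + 1 :=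
      Nat.exists_eq_succ_of_ne_zero (Nat.mul_ne_zero (Int.natAbs_ne_zero.2 hm0) hN.ne')
    rw [smul_add, smul_smul, hk, succ_nsmul', add_assoc] at e3
    exact hq0 (hpos q hq _ (pos.add_mem (pos.nsmul_mem hq _)
      (pos.nsmul_mem (pos.sum_mem fun x hx => pos.nsmul_mem (hs x hx) _) _)) e3)
  · refine ⟨(θ.toAddMonoidHom).comp f.toAddMonoidHom, h, ?_⟩
    rw [map_neg, neg_lt_zero] at h'
    exact h'

open Luk.LTAlg hiding neg

/-! ### The standard semantics -/

section Eval

variable {S : ScalarSet} {X : Type u}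

/-- The truth value of a formula in `[0,1]`. -/
noncomputable def Formula.eval (v : X → unitInterval) : Formula S X → ℝ
  | .var x => v x
  | .bot => 0
  | .neg φ => 1 - φ.eval v
  | .imp φ ψ => min 1 (1 - φ.eval v + ψ.eval v)
  | .nabla r φ => 1 - r.1 * (1 - φ.eval v)

namespace Formula

theorem eval_mem (v : X → unitInterval) (φ : Formula S X) : 0 ≤ φ.eval v ∧ φ.eval v ≤ 1 := by
  induction φ with
  | var x => exact (v x).2
  | bot => exact ⟨le_rfl, zero_le_one⟩
  | neg φ ih => simp only [eval]; constructor <;> linarith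
  | imp φ ψ ih1 ih2 =>
    exact ⟨le_min zero_le_one (by linarith), min_le_left _ _⟩
  | nabla r φ ih =>
    simp only [eval]
    have h0 := r.1.2.1
    have h1 := r.1.2.2
    constructor <;> nlinarith

theorem eval_imp_eq_one (v : X → unitInterval) (φ ψ : Formula S X) :
    (imp φ ψ).eval v = 1 ↔ φ.eval v ≤ ψ.eval v := by
  simp only [eval, min_eq_left_iff]
  constructor <;> intro h <;> linarith

theorem eval_lift {S' : ScalarSet} (h : S.carrier ⊆ S'.carrier) (v : X → unitInterval)
    (φ : Formula S X) : (φ.lift h).eval v = φ.eval v := by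
  induction φ with
  | var x => rfl
  | bot => rfl
  | neg φ ih => simp only [lift, eval, ih]
  | imp φ ψ ih1 ih2 => simp only [lift, eval, ih1, ih2]
  | nabla r φ ih => simp only [lift, eval, ih]

end Formula

theorem ScalarSet.coe_sub (r q : S.Elt) :
    ((ScalarSet.sub r q).1 : ℝ) = max 0 ((r.1 : ℝ) - q.1) := by
  change 1 - min 1 ((1 - (r.1 : ℝ)) + (1 - (1 - (q.1 : ℝ)))) = _
  rcases le_total (r.1 : ℝ) q.1 with h | h
  · rw [min_eq_left (by linarith), max_eq_left (by linarith)]; ring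
  · rw [min_eq_right (by linarith), max_eq_right (by linarith)]; ring

theorem Formula.eval_nabla_imp (v : X → unitInterval) (r : S.Elt) (φ ψ : Formula S X) :
    (nabla r (imp φ ψ)).eval v = (imp (nabla r φ) (nabla r ψ)).eval v := by
  simp only [eval]
  have h0 := r.1.2.1
  rcases le_total (φ.eval v) (ψ.eval v) with h | h
  · rw [min_eq_left (by linarith), min_eq_left (by nlinarith)]; ring
  · rw [min_eq_right (by linarith), min_eq_right (by nlinarith)]; ring

theorem Formula.eval_nabla_sub (v : X → unitInterval) (r q : S.Elt) (φ : Formula S X) :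
    (nabla (ScalarSet.sub r q) φ).eval v = (imp (nabla q φ) (nabla r φ)).eval v := by
  simp only [eval, ScalarSet.coe_sub]
  have h0 := (φ.eval_mem v).2
  rcases le_total (r.1 : ℝ) q.1 with h | h
  · rw [max_eq_left (by linarith), min_eq_left (by nlinarith)]; ring
  · rw [max_eq_right (by linarith), min_eq_right (by nlinarith)]; ring

/-- Soundness of the standard semantics. -/
theorem Provable.eval_eq_one {φ : Formula S X} (h : Provable φ) (v : X → unitInterval) :
    φ.eval v = 1 := by
  induction h with
  | L1 φ ψ =>
    rw [Formula.eval_imp_eq_one]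
    have := φ.eval_mem v
    have := ψ.eval_mem v
    exact le_min (by linarith) (by linarith)
  | L2 φ ψ χ =>
    rw [Formula.eval_imp_eq_one]
    simp only [Formula.eval]
    have := φ.eval_mem v
    have := ψ.eval_mem v
    have := χ.eval_mem v
    simp only [min_def]
    split_ifs <;> linarith
  | L3 φ ψ =>
    rw [Formula.eval_imp_eq_one]
    simp only [Formula.eval, Formula.or]
    have := φ.eval_mem v
    have := ψ.eval_mem v
    simp only [min_def]
    split_ifs <;> linarith
  | L4 φ ψ =>
    rw [Formula.eval_imp_eq_one]
    simp only [Formula.eval]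
    exact min_le_min le_rfl (by linarith)
  | efq φ => rw [Formula.eval_imp_eq_one]; exact (φ.eval_mem v).1
  | R1 r φ ψ => rw [Formula.eval_imp_eq_one, Formula.eval_nabla_imp]
  | R1' r φ ψ => rw [Formula.eval_imp_eq_one, Formula.eval_nabla_imp]
  | R2 r q φ => rw [Formula.eval_imp_eq_one, Formula.eval_nabla_sub]
  | R2' r q φ => rw [Formula.eval_imp_eq_one, Formula.eval_nabla_sub]
  | R3 r q φ =>
    rw [Formula.eval_imp_eq_one]
    simp only [Formula.eval, ScalarSet.mul, Set.Icc.coe_mul]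
    exact le_of_eq (by ring)
  | R3' r q φ =>
    rw [Formula.eval_imp_eq_one]
    simp only [Formula.eval, ScalarSet.mul, Set.Icc.coe_mul]
    exact le_of_eq (by ring)
  | R4 h φ => rw [Formula.eval_imp_eq_one]; simp [Formula.eval]
  | R4' h φ => rw [Formula.eval_imp_eq_one]; simp [Formula.eval]
  | @mp φ ψ _ _ h1 h2 =>
    rw [Formula.eval_imp_eq_one, h1] at h2
    exact le_antisymm (ψ.eval_mem v).2 h2

end Eval

/-! ### Completeness of the standard semantics for rational scalars -/

/-- Sets of rational scalars that contain all multiples `k / n ≤ 1` of the inverse of a denominator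
of each of their elements. -/
def ScalarSet.Rational (S : ScalarSet) : Prop :=
  ∀ r ∈ S.carrier, ∃ p n : ℕ, 0 < n ∧ p ≤ n ∧ (r : ℝ) = p / n ∧
    ∀ k ≤ n, ∃ t ∈ S.carrier, (t : ℝ) = k / n

theorem mvScalars_rational : mvScalars.Rational := fun _ h => h.elim

theorem dmvScalars_rational : dmvScalars.Rational := by
  rintro r ⟨q, hq⟩
  have hq0 : 0 ≤ q := by exact_mod_cast hq ▸ r.2.1
  have hq1 : q ≤ 1 := by exact_mod_cast hq ▸ r.2.2
  have e : (q.num.toNat : ℤ) = q.num := Int.toNat_of_nonneg (Rat.num_nonneg.2 hq0)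
  refine ⟨q.num.toNat, q.den, q.pos, ?_, ?_, fun k hk => ?_⟩
  · zify
    rw [e]
    exact Rat.num_le_denom_iff.2 hq1
  · rw [← hq, ← Int.cast_natCast, e]
    exact_mod_cast (Rat.num_div_den q).symm
  · have hd : (0 : ℝ) < q.den := by exact_mod_cast q.pos
    refine ⟨⟨k / q.den, by positivity, (div_le_one hd).2 (by exact_mod_cast hk)⟩,
      ⟨k / q.den, by push_cast; rfl⟩, rfl⟩

section

attribute [local instance] toAddCommMonoid toSub toPartialOrder orderedSub isOrderedAddMonoid
  canonicallyOrderedAdd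

namespace GroupState

variable {A : Type u}

theorem map_neg [MVAlgebra A] (s : GroupState A) (a : A) :
    s.map (neg a) = s.map one - s.map a := by
  rw [← neg_add_self a, s.map_add_of_le _ _ le_rfl, add_sub_cancel_right]

theorem map_sub_add [MVAlgebra A] (s : GroupState A) {a b : A} (h : b ≤ a) :
    s.map a = s.map (a - b) + s.map b := by
  rw [← s.map_add_of_le _ _ (sub_le_neg a b), tsub_add_cancel_of_le h]

variable {S : ScalarSet} [ScalarMVAlgebra S A]

open ScalarMVAlgebra

theorem _root_.Luk.ScalarMVAlgebra.scal_sub (r q : S.Elt) (x : A) :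
    scal (ScalarSet.sub r q) x = scal r x - scal q x := sub_scal r q x

/-- The scalars q ⊖ r and q ⊖ q coincide, so qx ⊖ rx = qx ⊖ qx = 0. -/
theorem _root_.Luk.ScalarMVAlgebra.scal_mono {r q : S.Elt} (h : (q.1 : ℝ) ≤ r.1) (x : A) :
    scal q x ≤ scal r x := by
  have e : ScalarSet.sub q r = ScalarSet.sub q q := by
    apply Subtype.ext; apply Subtype.ext
    rw [ScalarSet.coe_sub, ScalarSet.coe_sub, max_eq_left (by linarith), sub_self, max_self]
  rw [← tsub_eq_zero_iff_le, ← scal_sub, e, scal_sub, tsub_self]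

theorem map_scal_add (s : GroupState A) {r q t : S.Elt} (h : (r.1 : ℝ) = t.1 + q.1) (x : A) :
    s.map (scal r x) = s.map (scal t x) + s.map (scal q x) := by
  have ht := t.1.2.1
  have e : ScalarSet.sub r q = t := by
    apply Subtype.ext; apply Subtype.ext
    rw [ScalarSet.coe_sub, h, add_sub_cancel_right, max_eq_right ht]
  rw [s.map_sub_add (scal_mono (r := r) (q := q) (by linarith) x), ← scal_sub, e]

/-- For r = p/n the value at (k/n)x is additive in k, hence k times a constant c. Taking k = n gives
x itself, and k = p gives rx. -/
theorem apply_map_scal (hS : S.Rational) (s : GroupState A) (θ : s.G →+ ℝ) (r : S.Elt) (x : A) :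
    θ (s.map (scal r x)) = r.1 * θ (s.map x) := by
  obtain ⟨p, n, hn, hp, hr, hk⟩ := hS r.1 r.2
  choose! t ht ht' using hk
  have hn' : (n : ℝ) ≠ 0 := by exact_mod_cast hn.ne'
  let c : ℝ := θ (s.map (scal (⟨t 1, ht 1 hn⟩ : S.Elt) x))
  have key : ∀ k, ∀ hk : k ≤ n, θ (s.map (scal (⟨t k, ht k hk⟩ : S.Elt) x)) = k * c := by
    intro k
    induction k with
    | zero =>
      intro hk
      -- From 0 = 0 + 0, the image of 0·x is twice itself.
      have := s.map_scal_add (r := ⟨t 0, ht 0 hk⟩) (t := ⟨t 0, ht 0 hk⟩) (q := ⟨t 0, ht 0 hk⟩)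
        (by simp [ht' 0 hk]) x
      rw [left_eq_add] at this
      rw [this, _root_.map_zero, Nat.cast_zero, zero_mul]
    | succ k ih =>
      intro hk
      rw [s.map_scal_add (t := ⟨t k, ht k (by omega)⟩) (q := ⟨t 1, ht 1 hn⟩)
        (by simp only [ht' _ hk, ht' k (by omega), ht' 1 hn]; push_cast; ring) x, _root_.map_add,
        ih (by omega)]
      push_cast; ring
  have h1 : t n = 1 := by
    apply Subtype.ext
    rw [ht' n le_rfl, div_self hn']; rfl
  have hone : θ (s.map x) = n * c := by
    rw [← key n le_rfl]
    have hmem : (1 : unitInterval) ∈ S.carrier := S.one_mem r.2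
    have e : (⟨t n, ht n le_rfl⟩ : S.Elt) = ⟨1, hmem⟩ := Subtype.ext h1
    rw [e, one_scal]
  have e : r = ⟨t p, ht p hp⟩ := Subtype.ext (Subtype.ext (hr.trans (ht' p hp).symm))
  rw [hone, hr]
  conv_lhs => rw [e]
  rw [key p hp]
  field_simp

end GroupState

variable {S : ScalarSet} {X : Type u}

/-- The valuation that a real functional induces. -/
noncomputable def GroupState.valuation (s : GroupState (LTAlg S X)) (θ : s.G →+ ℝ) (x : X) :
    unitInterval := Set.projIcc 0 1 zero_le_one (θ (s.map (var x)))

/-- In the group it is already decided which sums are truncated. A functional that is nonnegative at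
the finitely many cone elements witnessing these decisions makes the same choices in [0,1].
Finiteness of P is what lets Farkas' lemma apply. -/
theorem exists_finset_eval_eq (hS : S.Rational) (s : GroupState (LTAlg S X)) (φ : Formula S X) :
    ∃ P : Finset s.G, (∀ x ∈ P, x ∈ s.pos) ∧ ∀ θ : s.G →+ ℝ, θ (s.map one) = 1 →
      (∀ x ∈ P, 0 ≤ θ x) → φ.eval (s.valuation θ) = θ (s.map (mk φ)) := by
  classical
  induction φ with
  | var x =>
    refine ⟨{s.map (var x), s.map (neg (var x))}, ?_, fun θ h1 hθ => ?_⟩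
    · intro y hy
      simp only [Finset.mem_insert, Finset.mem_singleton] at hy
      rcases hy with rfl | rfl <;> exact s.map_mem _
    · have h2 := hθ (s.map (var x)) (by simp)
      have h3 := hθ (s.map (neg (var x))) (by simp)
      rw [s.map_neg, map_sub, h1, sub_nonneg] at h3
      change ((Set.projIcc 0 1 zero_le_one (θ (s.map (var x))) : unitInterval) : ℝ) = _
      rw [Set.projIcc_of_mem zero_le_one ⟨h2, h3⟩]
      rfl
  | bot =>
    refine ⟨∅, by simp, fun θ _ _ => ?_⟩
    change (0 : ℝ) = θ (s.map 0)
    rw [s.map_zero, map_zero]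
  | neg φ ih =>
    obtain ⟨P, hP, h⟩ := ih
    refine ⟨P, hP, fun θ h1 hθ => ?_⟩
    change 1 - φ.eval _ = θ (s.map (neg (mk φ)))
    rw [s.map_neg, map_sub, h1, h θ h1 hθ]
  | imp φ ψ ih1 ih2 =>
    obtain ⟨P, hP, h⟩ := ih1
    obtain ⟨Q, hQ, k⟩ := ih2
    rw [mk_imp, oplus_eq_add]
    have e : ∀ θ : s.G →+ ℝ, θ (s.map one) = 1 → (∀ x ∈ P, 0 ≤ θ x) → (∀ x ∈ Q, 0 ≤ θ x) →
        (φ.imp ψ).eval (s.valuation θ)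
          = min 1 (θ (s.map (neg (mk φ))) + θ (s.map (mk ψ))) := fun θ h1 hp hq => by
      rw [s.map_neg, map_sub, h1, ← h θ h1 hp, ← k θ h1 hq]
      rfl
    -- P receives the negation of the sum if there is no truncation (so the sum is at most 1), and
    -- the excess over 1 otherwise.
    rcases s.map_add (neg (mk φ)) (mk ψ) with h' | ⟨h', h''⟩
    · refine ⟨P ∪ Q ∪ {s.map (neg (neg (mk φ) + mk ψ))}, fun x hx => ?_, fun θ h1 hθ => ?_⟩
      · simp only [Finset.mem_union, Finset.mem_singleton] at hx
        rcases hx with (hx | hx) | rfl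
        exacts [hP x hx, hQ x hx, s.map_mem _]
      · have h2 := hθ (s.map (neg (neg (mk φ) + mk ψ))) (by simp)
        rw [s.map_neg, map_sub, h1, sub_nonneg] at h2
        rw [e θ h1 (fun x hx => hθ x (by simp [hx])) (fun x hx => hθ x (by simp [hx])),
          ← _root_.map_add, ← h', min_eq_right h2]
    · refine ⟨P ∪ Q ∪ {s.map (neg (mk φ)) + s.map (mk ψ) - s.map one}, fun x hx => ?_,
        fun θ h1 hθ => ?_⟩
      · simp only [Finset.mem_union, Finset.mem_singleton] at hx
        rcases hx with (hx | hx) | rfl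
        exacts [hP x hx, hQ x hx, h'']
      · have h2 := hθ (s.map (neg (mk φ)) + s.map (mk ψ) - s.map one) (by simp)
        rw [map_sub, h1, sub_nonneg, _root_.map_add] at h2
        rw [e θ h1 (fun x hx => hθ x (by simp [hx])) (fun x hx => hθ x (by simp [hx])),
          min_eq_left h2, h', h1]
  | nabla r φ ih =>
    obtain ⟨P, hP, h⟩ := ih
    refine ⟨P, hP, fun θ h1 hθ => ?_⟩
    rw [mk_nabla, s.map_neg, map_sub, h1, GroupState.apply_map_scal hS, s.map_neg, map_sub, h1,
      ← h θ h1 hθ]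
    rfl

/-- Completeness of the standard semantics for Łukasiewicz logic with rational scalars. -/
theorem provable_of_eval (hS : S.Rational) {φ : Formula S X}
    (h : ∀ v : X → unitInterval, φ.eval v = 1) : Provable φ := by
  classical
  by_contra hφ
  have h0 : (neg (mk φ) : LTAlg S X) ≠ 0 := fun e => hφ <| by
    have e' : mk φ = mk (Formula.neg .bot) := MVAlgebra.neg_inj (e.trans (MVAlgebra.neg_neg _).symm)
    exact .mp .not_bot (LTAlg.exact e').2
  obtain ⟨s, hs⟩ := exists_groupState h0
  obtain ⟨P, hP, hev⟩ := exists_finset_eval_eq hS s φ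
  -- Including φ itself makes θ positive at 1 = ¬φ + φ, so that θ can be normalised.
  obtain ⟨θ, hθ, hq⟩ := exists_addMonoidHom_rat s.pos s.eq_zero_of_add (insert (s.map (mk φ)) P)
    (fun x hx => by
      rcases Finset.mem_insert.1 hx with rfl | hx
      exacts [s.map_mem _, hP x hx]) (s.map_mem _) hs
  have h1 : 0 < θ (s.map one) := by
    have := hθ _ (Finset.mem_insert_self _ _)
    rw [s.map_neg, map_sub] at hq
    linarith
  let η : s.G →+ ℝ := (AddMonoidHom.mulLeft ((θ (s.map one) : ℝ)⁻¹)).comp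
    ((Rat.castHom ℝ).toAddMonoidHom.comp θ)
  have hη : ∀ x, η x = (θ (s.map one) : ℝ)⁻¹ * (θ x : ℝ) := fun _ => rfl
  have h1' : (0 : ℝ) < θ (s.map one) := by exact_mod_cast h1
  have hone : η (s.map one) = 1 := by rw [hη, inv_mul_cancel₀ h1'.ne']
  have e := hev η hone fun x hx => by
    rw [hη]
    have : (0 : ℝ) ≤ θ x := by exact_mod_cast hθ x (Finset.mem_insert_of_mem hx)
    positivity
  have hq' : 0 < η (s.map (neg (mk φ))) := by
    rw [hη]
    have : (0 : ℝ) < θ (s.map (neg (mk φ))) := by exact_mod_cast hq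
    positivity
  rw [s.map_neg, map_sub, hone, ← e, h] at hq'
  simp at hq'

end

/-! ### Truncations of integral combinations of truth functions -/

section McNaughton

variable {X : Type u}

/-- Truth functions of formulas of Łukasiewicz logic. -/
def IsMVFunction (f : (X → unitInterval) → ℝ) : Prop :=
  ∃ φ : Formula mvScalars X, ∀ v, f v = φ.eval v

namespace IsMVFunction

variable {f g : (X → unitInterval) → ℝ}

theorem mem (hf : IsMVFunction f) (v : X → unitInterval) : 0 ≤ f v ∧ f v ≤ 1 := by
  obtain ⟨φ, hφ⟩ := hf
  rw [hφ]; exact φ.eval_mem v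

theorem zero : IsMVFunction (0 : (X → unitInterval) → ℝ) := ⟨.bot, fun _ => rfl⟩

theorem one_sub (hf : IsMVFunction f) : IsMVFunction (1 - f) := by
  obtain ⟨φ, hφ⟩ := hf
  exact ⟨.neg φ, fun v => by simp [Formula.eval, hφ]⟩

theorem one : IsMVFunction (1 : (X → unitInterval) → ℝ) := by simpa using zero.one_sub

theorem min_add (hf : IsMVFunction f) (hg : IsMVFunction g) :
    IsMVFunction fun v => min 1 (f v + g v) := by
  obtain ⟨φ, hφ⟩ := hf
  obtain ⟨ψ, hψ⟩ := hg
  exact ⟨.imp (.neg φ) ψ, fun v => by simp [Formula.eval, hφ, hψ]⟩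

theorem max_add_sub (hf : IsMVFunction f) (hg : IsMVFunction g) :
    IsMVFunction fun v => max 0 (f v + g v - 1) := by
  convert! (hf.one_sub.min_add hg.one_sub).one_sub using 1
  funext v
  simp only [Pi.sub_apply, Pi.one_apply]
  rcases le_total (f v + g v) 1 with h | h
  · rw [max_eq_left (by linarith), min_eq_left (by linarith), sub_self]
  · rw [max_eq_right (by linarith), min_eq_right (by linarith)]; ring

end IsMVFunction

/-- Truncation of a real number to `[0,1]`. -/
noncomputable def trunc (t : ℝ) : ℝ := max 0 (min 1 t)

/-- The right side is (trunc t ⊕ s) ⊙ trunc (t + 1): the last factor is 1 for t ≥ 0, and for t < 0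
it removes the deficit. -/
theorem trunc_add {t s : ℝ} (h0 : 0 ≤ s) (h1 : s ≤ 1) :
    trunc (t + s) = max 0 (min 1 (trunc t + s) + trunc (t + 1) - 1) := by
  simp only [trunc, min_def, max_def]
  split_ifs <;> linarith

/-- Functions all whose integral translates truncate to truth functions. -/
def HasMVTruncations (f : (X → unitInterval) → ℝ) : Prop :=
  ∀ k : ℤ, IsMVFunction fun v => trunc (f v - k)

namespace HasMVTruncations

variable {f g : (X → unitInterval) → ℝ}

theorem zero : HasMVTruncations (0 : (X → unitInterval) → ℝ) := by
  intro k
  rcases le_or_gt 0 k with h | h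
  · convert! IsMVFunction.zero using 1
    funext v
    have : (0 : ℝ) ≤ k := by exact_mod_cast h
    simp [trunc, this]
  · convert! IsMVFunction.one using 1
    funext v
    have : (k : ℝ) ≤ -1 := by exact_mod_cast Int.le_sub_one_of_lt h
    simp only [trunc, Pi.zero_apply, Pi.one_apply]
    rw [min_eq_left (by linarith), max_eq_right zero_le_one]

/-- Truncating f + g − k uses the truncations of f − k and f − (k − 1), which is why all integral
translates are required. -/
theorem add (hf : HasMVTruncations f) (hg : IsMVFunction g) : HasMVTruncations (f + g) := by
  intro k
  convert! ((hf k).min_add hg).max_add_sub (hf (k - 1)) using 1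
  funext v
  have h := hg.mem v
  have e : (f + g) v - k = f v - k + g v := by rw [Pi.add_apply]; ring
  rw [e, trunc_add h.1 h.2]
  have e' : f v - ((k - 1 : ℤ) : ℝ) = f v - k + 1 := by push_cast; ring
  rw [e']

theorem sub (hf : HasMVTruncations f) (hg : IsMVFunction g) : HasMVTruncations (f - g) := by
  intro k
  -- f − g − k = f + (1 − g) − (k + 1).
  convert! hf.add hg.one_sub (k + 1) using 1
  funext v
  simp only [Pi.add_apply, Pi.sub_apply, Pi.one_apply]
  congr 1
  push_cast; ring

end HasMVTruncations

/-- The group of integral combinations of truth functions. -/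
def mvFunctionGroup (X : Type u) : AddSubgroup ((X → unitInterval) → ℝ) :=
  AddSubgroup.closure {f | IsMVFunction f}

theorem IsMVFunction.mem_mvFunctionGroup {f : (X → unitInterval) → ℝ} (hf : IsMVFunction f) :
    f ∈ mvFunctionGroup X := AddSubgroup.subset_closure hf

theorem hasMVTruncations_of_mem {f : (X → unitInterval) → ℝ} (hf : f ∈ mvFunctionGroup X) :
    HasMVTruncations f := by
  -- A general f lets summands be added one at a time; treating both signs together lets the
  -- induction pass through negation.
  have key : ∀ g ∈ mvFunctionGroup X, ∀ f : (X → unitInterval) → ℝ, HasMVTruncations f →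
      HasMVTruncations (f + g) ∧ HasMVTruncations (f - g) := by
    intro g hg
    induction hg using AddSubgroup.closure_induction with
    | mem g hg =>
      have hg : IsMVFunction g := hg
      exact fun f hf => ⟨hf.add hg, hf.sub hg⟩
    | zero => intro f hf; rw [add_zero, sub_zero]; exact ⟨hf, hf⟩
    | add g g' _ _ h h' =>
      intro f hf
      rw [← add_assoc, ← sub_sub]
      exact ⟨(h' _ (h _ hf).1).1, (h' _ (h _ hf).2).2⟩
    | neg g _ h =>
      intro f hf
      rw [← sub_eq_add_neg, sub_neg_eq_add]
      exact (h f hf).symm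
  have := (key f hf 0 HasMVTruncations.zero).1
  rwa [zero_add] at this

theorem natCast_mem_mvFunctionGroup (n : ℕ) :
    (n : (X → unitInterval) → ℝ) ∈ mvFunctionGroup X := by
  rw [← nsmul_one]
  exact AddSubgroup.nsmul_mem _ IsMVFunction.one.mem_mvFunctionGroup n

/-- Slice by unit heights: min(n + 1, f) = min(n, f) + trunc(f − n), and the last term is a truth
function. -/
theorem min_mem_mvFunctionGroup {f : (X → unitInterval) → ℝ} (hf : f ∈ mvFunctionGroup X)
    (h0 : ∀ v, 0 ≤ f v) (n : ℕ) : (fun v => min (n : ℝ) (f v)) ∈ mvFunctionGroup X := by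
  induction n with
  | zero =>
    convert! (mvFunctionGroup X).zero_mem using 1
    funext v
    simp [h0 v]
  | succ n ih =>
    convert! (mvFunctionGroup X).add_mem ih
      (hasMVTruncations_of_mem hf n).mem_mvFunctionGroup using 1
    funext v
    have h := h0 v
    have hn : (0 : ℝ) ≤ n := Nat.cast_nonneg n
    simp only [Pi.add_apply, trunc, Int.cast_natCast, Nat.cast_succ, min_def, max_def]
    split_ifs <;> linarith

/-- Denominators multiply up. For an implication, NM·min(1, t) = min(NM, NM·t); for ∇ with r = p/n,
the multiple by nN is nN − pN + p·(Nφ). -/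
theorem exists_nsmul_eval_mem (φ : Formula dmvScalars X) :
    ∃ N : ℕ, 0 < N ∧ N • (fun v => φ.eval v) ∈ mvFunctionGroup X := by
  induction φ with
  | var x => exact ⟨1, one_pos, by
      rw [one_smul]; exact IsMVFunction.mem_mvFunctionGroup ⟨.var x, fun _ => rfl⟩⟩
  | bot => exact ⟨1, one_pos, by
      rw [one_smul]; exact IsMVFunction.mem_mvFunctionGroup ⟨.bot, fun _ => rfl⟩⟩
  | neg φ ih =>
    obtain ⟨N, hN, h⟩ := ih
    refine ⟨N, hN, ?_⟩
    convert! (mvFunctionGroup X).sub_mem (natCast_mem_mvFunctionGroup N) h using 1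
    funext v
    simp only [Pi.smul_apply, Pi.sub_apply, Pi.natCast_apply, Formula.eval]
    simp only [nsmul_eq_mul]
    ring
  | imp φ ψ ih1 ih2 =>
    obtain ⟨N, hN, h⟩ := ih1
    obtain ⟨M, hM, k⟩ := ih2
    refine ⟨N * M, Nat.mul_pos hN hM, ?_⟩
    have hmem := (mvFunctionGroup X).add_mem ((mvFunctionGroup X).sub_mem
      (natCast_mem_mvFunctionGroup (N * M)) (AddSubgroup.nsmul_mem _ h M))
      (AddSubgroup.nsmul_mem _ k N)
    have e : ∀ v, ((N * M : ℕ) - M • N • (fun v => φ.eval v) + N • M • fun v => ψ.eval v) v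
        = (N * M : ℕ) * (1 - φ.eval v + ψ.eval v) := fun v => by
      simp only [Pi.smul_apply, Pi.sub_apply, Pi.add_apply, Pi.natCast_apply]
      simp only [nsmul_eq_mul]
      push_cast; ring
    have hNM : (0 : ℝ) ≤ (N * M : ℕ) := Nat.cast_nonneg _
    convert! min_mem_mvFunctionGroup hmem (fun v => by
      rw [e]
      exact mul_nonneg hNM (by linarith [φ.eval_mem v, ψ.eval_mem v])) (N * M) using 1
    funext v
    rw [e]
    simp only [Pi.smul_apply, Formula.eval]
    rw [nsmul_eq_mul, mul_min_of_nonneg _ _ hNM, mul_one]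
  | nabla r φ ih =>
    obtain ⟨N, hN, h⟩ := ih
    obtain ⟨p, n, hn, -, hr, -⟩ := dmvScalars_rational r.1 r.2
    refine ⟨n * N, Nat.mul_pos hn hN, ?_⟩
    convert! (mvFunctionGroup X).add_mem ((mvFunctionGroup X).sub_mem
      (natCast_mem_mvFunctionGroup (n * N)) (natCast_mem_mvFunctionGroup (p * N)))
      (AddSubgroup.nsmul_mem _ h p) using 1
    funext v
    have hn' : (n : ℝ) ≠ 0 := by exact_mod_cast hn.ne'
    simp only [Pi.smul_apply, Pi.sub_apply, Pi.add_apply, Pi.natCast_apply,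
      Formula.eval, hr]
    simp only [nsmul_eq_mul]
    push_cast
    field_simp
    ring

/-- A multiple of the truth function of a rational formula is a truth function of Łukasiewicz
logic. -/
theorem exists_eval_eq_min (φ : Formula dmvScalars X) :
    ∃ N : ℕ, 0 < N ∧ ∃ ψ : Formula mvScalars X, ∀ v, ψ.eval v = min 1 (N * φ.eval v) := by
  obtain ⟨N, hN, h⟩ := exists_nsmul_eval_mem φ
  obtain ⟨ψ, hψ⟩ := hasMVTruncations_of_mem h 0
  refine ⟨N, hN, ψ, fun v => ?_⟩
  rw [← hψ v]
  have h0 : 0 ≤ (N : ℝ) * φ.eval v := mul_nonneg (Nat.cast_nonneg _) (φ.eval_mem v).1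
  simp only [trunc, Pi.smul_apply, nsmul_eq_mul, Int.cast_zero, sub_zero]
  rw [max_eq_right (le_min zero_le_one h0)]

end McNaughton

/-! ### Comparison of the ideals -/

section

attribute [local instance] toAddCommMonoid toSub toPartialOrder orderedSub isOrderedAddMonoid
  canonicallyOrderedAdd

variable {S : ScalarSet} {X : Type u}

/-- The `n`-fold sum of a formula. -/
def Formula.nFold (φ : Formula S X) : ℕ → Formula S X
  | 0 => .bot
  | n + 1 => .imp (.neg (φ.nFold n)) φ

theorem mk_nFold (φ : Formula S X) (n : ℕ) : mk (φ.nFold n) = n • mk φ := by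
  induction n with
  | zero => rw [zero_smul]; rfl
  | succ n ih => rw [succ_nsmul, ← ih]; rfl

theorem Formula.eval_nFold (φ : Formula S X) (n : ℕ) (v : X → unitInterval) :
    (φ.nFold n).eval v = min 1 (n * φ.eval v) := by
  induction n with
  | zero => simp [nFold, eval]
  | succ n ih =>
    have h0 := (φ.eval_mem v).1
    simp only [nFold, eval, ih, Nat.cast_succ, add_mul, one_mul, sub_sub_cancel, min_def]
    split_ifs <;> linarith

theorem mk_le_mk {φ ψ : Formula S X} (h : Provable (.imp φ ψ)) : mk φ ≤ mk ψ := by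
  change oplus (MVAlgebra.neg (mk φ)) (mk ψ) = one
  rw [← mk_imp]
  exact sound_of_provable h .not_bot

theorem incl_oplus {S' : ScalarSet} (h : S.carrier ⊆ S'.carrier) (a b : LTAlg S X) :
    incl h (oplus a b) = oplus (incl h a) (incl h b) := by
  induction a using ind with | h φ =>
  induction b using ind with | h ψ => rfl

theorem incl_neg {S' : ScalarSet} (h : S.carrier ⊆ S'.carrier) (a : LTAlg S X) :
    incl h (MVAlgebra.neg a) = MVAlgebra.neg (incl h a) := by
  induction a using ind with | h φ => rfl

theorem incl_mono {S' : ScalarSet} (h : S.carrier ⊆ S'.carrier) {a b : LTAlg S X} (k : a ≤ b) :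
    incl h a ≤ incl h b := by
  have e := congrArg (incl h) k
  rw [incl_oplus, incl_neg] at e
  exact e

theorem incl_nsmul {S' : ScalarSet} (h : S.carrier ⊆ S'.carrier) (a : LTAlg S X) (n : ℕ) :
    incl h (n • a) = n • incl h a := by
  induction n with
  | zero => rw [zero_smul, zero_smul]; rfl
  | succ n ih =>
    rw [succ_nsmul, succ_nsmul, ← ih]
    exact incl_oplus h _ _

theorem MVIdeal.span_singleton_subset {A : Type u} [MVAlgebra A] {a b : A} {n : ℕ}
    (h : a ≤ n • b) : (span {a}).carrier ⊆ (span {b}).carrier :=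
  span_le (Set.singleton_subset_iff.2 ((mem_span_singleton b a).2 ⟨n, h⟩))

/-- The ideal generated by an element of the rational algebra is generated by an MV-element. -/
theorem exists_span_incl_eq (f : DMVFree X) : ∃ g : MVFree X,
    ∀ (S : ScalarSet) (h : dmvScalars.carrier ⊆ S.carrier),
      MVIdeal.span {incl h f} = MVIdeal.span {mvIncl S g} := by
  induction f using ind with | h φ =>
  obtain ⟨N, hN, ψ, hψ⟩ := exists_eval_eq_min φ
  refine ⟨mk ψ, fun S h => ?_⟩
  have hlift := fun v => Formula.eval_lift (S' := dmvScalars)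
    (show mvScalars.carrier ⊆ _ from Set.empty_subset _) v ψ
  -- Both comparisons, φ ≤ ψ and ψ ≤ Nφ, are proved in the rational logic and then carried to S by
  -- the inclusion, so one ψ serves every S.
  have h1 : mk φ ≤ mvIncl dmvScalars (mk ψ) :=
    mk_le_mk <| provable_of_eval dmvScalars_rational fun v => by
      refine (Formula.eval_imp_eq_one v _ _).2 (le_of_le_of_eq ?_ (hlift v).symm)
      rw [hψ]
      have := φ.eval_mem v
      have hN' : (1 : ℝ) ≤ N := by exact_mod_cast hN
      exact le_min this.2 (le_mul_of_one_le_left this.1 hN')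
  have h2 : mvIncl dmvScalars (mk ψ) ≤ N • mk φ := by
    rw [← mk_nFold]
    refine mk_le_mk <| provable_of_eval dmvScalars_rational fun v => ?_
    refine (Formula.eval_imp_eq_one v _ _).2 ((hlift v).trans_le ?_)
    rw [hψ, Formula.eval_nFold]
  replace h1 := incl_mono h h1
  replace h2 := incl_mono h h2
  rw [incl_nsmul] at h2
  rw [incl_mvIncl] at h1 h2
  apply MVIdeal.ext'
  refine Set.Subset.antisymm (MVIdeal.span_singleton_subset (n := 1) ?_)
    (MVIdeal.span_singleton_subset h2)
  rwa [one_smul]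

/-- The logics with scalars are conservative over Łukasiewicz logic. -/
theorem mvIncl_injective (S : ScalarSet) (X : Type u) :
    Function.Injective (mvIncl S (X := X)) := by
  have key : ∀ φ ψ : Formula mvScalars X, mvIncl S (mk φ) = mvIncl S (mk ψ) →
      Provable (.imp φ ψ) := fun φ ψ h =>
    -- Completeness is needed only for Ł; the logic over S contributes soundness.
    provable_of_eval mvScalars_rational fun v => by
      rw [← Formula.eval_lift (show mvScalars.carrier ⊆ S.carrier from Set.empty_subset _)]
      exact (LTAlg.exact h).1.eval_eq_one v
  intro a b h
  induction a using ind with | h φ =>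
  induction b using ind with | h ψ => exact sound (key _ _ h) (key _ _ h.symm)

theorem le_of_mvIncl_le {a b : MVFree X} (h : mvIncl S a ≤ mvIncl S b) : a ≤ b := by
  have e : oplus (MVAlgebra.neg (mvIncl S a)) (mvIncl S b) = one := h
  rw [← mvIncl_neg, ← mvIncl_oplus] at e
  exact mvIncl_injective S X e

theorem MVIdeal.FG.exists_eq_span_singleton {A : Type u} [MVAlgebra A] {I : MVIdeal A}
    (h : I.FG) : ∃ a : A, I = MVIdeal.span {a} := by
  obtain ⟨t, ht, rfl⟩ := h
  obtain ⟨a, ha⟩ := MVIdeal.exists_single ht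
  refine ⟨a, MVIdeal.ext' (Set.Subset.antisymm ?_ ?_)⟩
  · exact span_le ((ha _).2 (subset_span _ (Set.mem_singleton a)))
  · exact span_le (Set.singleton_subset_iff.2 ((ha _).1 (subset_span _)))

/-- A finitely generated ideal is principal, I = (a], so membership is a single inequality with a
multiple of a, and ι reflects it. -/
theorem mem_of_mvIncl_mem_extend {I : MVIdeal (MVFree X)} (hI : I.FG) {b : MVFree X}
    (h : mvIncl S b ∈ (extend S I).carrier) : b ∈ I.carrier := by
  obtain ⟨a, rfl⟩ := hI.exists_eq_span_singleton
  rw [extend_span, Set.image_singleton, MVIdeal.mem_span_singleton] at h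
  obtain ⟨n, hn⟩ := h
  refine (MVIdeal.mem_span_singleton a b).2 ⟨n, le_of_mvIncl_le (S := S) (hn.trans (le_of_eq ?_))⟩
  exact (incl_nsmul _ a n).symm

end

/-! ### The equivalences -/

section

variable (S : ScalarSet)

instance : (extendFunctor.{u} S).Faithful where
  map_injective {T T'} σ τ h := by
    apply Theory.Hom.ext
    apply hom_ext
    intro x
    apply mvIncl_injective S
    have e : extendHom S σ.hom = extendHom S τ.hom := congrArg (fun f => f.hom.hom) h
    rw [← extendHom_var, ← extendHom_var, e]

instance : (extendFunctor.{u} S).Full where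
  map_surjective {T T'} τ := by
    -- MV-preimages of the images of the variables define a substitution over Ł that extends to τ.
    choose s hs using τ.property
    have hvar : ∀ x, τ.hom.hom.toFun (var x) = mvIncl S ((substHom s).toFun (var x)) := fun x => by
      rw [substHom_var]; exact (hs x).symm
    refine ⟨⟨substHom s, fun a ha => ?_⟩, ?_⟩
    · apply mem_of_mvIncl_mem_extend (S := S) T'.fg
      refine Eq.subst (motive := (· ∈ (extend S T'.I).carrier))
        (mvIncl_comm (substHom s) τ.hom.hom hvar a) ?_
      exact τ.hom.map_mem _ (MVIdeal.subset_span _ ⟨a, ha, rfl⟩)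
    · apply WideSubcategory.hom_ext
      apply Theory.Hom.ext
      apply hom_ext
      intro x
      exact (extendHom_var S _ x).trans (hvar x).symm

variable {S}

/-- Essential surjectivity holds on the nose: the variables stay the same, and the generator is
replaced by an MV-element generating the same ideal. -/
theorem exists_extendFunctor_obj_eq (h : dmvScalars.carrier ⊆ S.carrier)
    (T : WideSubcategory (mvPreserving.{u} S)) (f : DMVFree T.obj.X)
    (hf : T.obj.I = MVIdeal.span {incl h f}) : ∃ T₀, (extendFunctor S).obj T₀ = T := by
  obtain ⟨g, hg⟩ := exists_span_incl_eq f
  obtain ⟨⟨X, I, hI⟩⟩ := T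
  change DMVFree X at f
  change MVFree X at g
  refine ⟨⟨X, MVIdeal.span {g}, {g}, Set.finite_singleton g, rfl⟩, ?_⟩
  have e : extend S (MVIdeal.span {g}) = I := by
    rw [extend_span, Set.image_singleton, ← hg S h]; exact hf.symm
  subst e
  rfl

theorem incl_refl {X : Type u} (a : LTAlg S X) : incl (Set.Subset.refl S.carrier) a = a := by
  induction a using ind with | h φ =>
  change LTAlg.mk _ = LTAlg.mk _
  congr 1
  induction φ with
  | var x => rfl
  | bot => rfl
  | neg φ ih => exact congrArg Formula.neg ih
  | imp φ ψ ih1 ih2 => exact congrArg₂ Formula.imp ih1 ih2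
  | nabla r φ ih => exact congrArg (Formula.nabla r) ih

instance : DT.{u}.EssSurj where
  mem_essImage T := by
    obtain ⟨f, hf⟩ := T.obj.fg.exists_eq_span_singleton
    obtain ⟨T₀, h⟩ := exists_extendFunctor_obj_eq (Set.Subset.refl _) T f (by rw [incl_refl, hf])
    exact ⟨T₀, ⟨eqToIso h⟩⟩

instance : RT.{u}.EssSurj where
  mem_essImage T := by
    obtain ⟨f, hf⟩ := T.property
    obtain ⟨T₀, h⟩ := exists_extendFunctor_obj_eq (Set.subset_univ _) T.obj f hf
    refine ⟨T₀, ⟨eqToIso ?_⟩⟩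
    obtain ⟨T, hT⟩ := T
    subst h
    rfl

theorem DT_isEquivalence : DT.{u}.IsEquivalence :=
  have : DT.{u}.Faithful := inferInstanceAs (extendFunctor dmvScalars).Faithful
  have : DT.{u}.Full := inferInstanceAs (extendFunctor dmvScalars).Full
  {}

theorem RT_isEquivalence : RT.{u}.IsEquivalence :=
  have : RT.{u}.Faithful := by unfold RT; infer_instance
  have : RT.{u}.Full := by unfold RT; infer_instance
  {}

theorem eq_extendHom_iff {X : Type u} {Y : Type v} (σ : ScalarHom mvScalars (MVFree X) (MVFree Y))
    (τ : ScalarHom S (LTAlg S X) (LTAlg S Y)) :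
    τ = extendHom S σ ↔ ∀ x : X, τ.toFun (var x) = mvIncl S (σ.toFun (var x)) := by
  constructor
  · rintro rfl x
    exact extendHom_var S σ x
  · intro h
    exact hom_ext fun x => (h x).trans (extendHom_var S σ x).symm

end

end Luk

theorem mainTheorem10 :
    -- on objects, `(X, I) ↦ (X, (I])`
    (∀ T : ThMV.{u}, ∃ h, (DT.obj T).obj =
      (⟨T.X, MVIdeal.span (LTAlg.mvIncl dmvScalars '' T.I.carrier), h⟩ : ThDMV.{u})) ∧
    -- on arrows, the image of `σ` is the unique morphism that agrees with `σ` on the variables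
    (∀ (T T' : ThMV.{u}) (σ : T ⟶ T') (τ : ScalarHom dmvScalars (DMVFree T.X) (DMVFree T'.X)),
      τ = (DT.map σ).hom.hom ↔
        ∀ x : T.X, τ.toFun (LTAlg.var x) =
          LTAlg.mvIncl dmvScalars (σ.hom.toFun (LTAlg.var x))) ∧
    DT.{u}.IsEquivalence ∧
    -- the same for `ThRMV'`
    (∀ T : ThMV.{u}, ∃ h, (RT.obj T).obj.obj =
      (⟨T.X, MVIdeal.span (LTAlg.mvIncl rmvScalars '' T.I.carrier), h⟩ :
        Theory.{u} rmvScalars)) ∧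
    (∀ (T T' : ThMV.{u}) (σ : T ⟶ T') (τ : ScalarHom rmvScalars (RMVFree T.X) (RMVFree T'.X)),
      τ = (RT.map σ).hom.hom.hom ↔
        ∀ x : T.X, τ.toFun (LTAlg.var x) =
          LTAlg.mvIncl rmvScalars (σ.hom.toFun (LTAlg.var x))) ∧
    RT.{u}.IsEquivalence := by
  exact ⟨fun T => ⟨_, rfl⟩, fun _ _ σ τ => eq_extendHom_iff σ.hom τ, DT_isEquivalence,
    fun T => ⟨_, rfl⟩, fun _ _ σ τ => eq_extendHom_iff σ.hom τ, RT_isEquivalence⟩
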